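/- Fix a function $H\colon\mathbb R\to\mathbb R$ such that: the germ of $H$ at $0$ is weakly $C^\infty$ (for every $p$ it has a $C^p$ representative near $0$) but not $C^\infty$; off any neighbourhood of $0$, $H$ is piecewise given by finitely many polynomials; and the algebras $\mathcal A_n=\mathcal A_n(H)$ below are quasianalytic, i.e. the map sending a germ in $\mathcal A_n$ to its Taylor series at $0$ is injective for every $n\ge 0$. Here $(\mathcal A_n)_{n\ge0}$ is the smallest family of subalgebras of the algebras of weakly $C^\infty$ germs at $0\in\mathbb R^n$ such that: $\mathcal A_1$ contains the germ of $H$ and $\mathcal A_n$ contains the polynomial germs; if $f\in\mathcal A_n$ vanishes on $x_i=0$, the continuous extension of $f/x_i$ is in $\mathcal A_n$; if $f\in\mathcal A_m$ and $g_1,\dots,g_m\in\mathcal A_n$ with $g_j(0)=0$, then $f(g_1,\dots,g_m)\in\mathcal A_n$; if $f\in\mathcal A_{n+1}$, $f(0)=0$ and $\frac{\partial f}{\partial x_{n+1}}(0)\ne0$, the weakly $C^\infty$ germ $\varphi$ with $\varphi(0)=0$ and $f(x',\varphi(x'))=0$ is in $\mathcal A_n$. A polydisk is a set $I_r=\prod_{i=1}^n(-r_i,r_i)\subset\mathbb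 R^n$ with all $r_i>0$; for a continuous $f\colon I_r\to\mathbb R$ write $f\in\mathcal A_n$ if its germ at $0$ is in $\mathcal A_n$. An $H$-basic set is a set $\{x\in I_r : g_0(x)=0,\ g_1(x)>0,\dots,g_q(x)>0\}$, where $g_0,\dots,g_q\in\mathcal A_n$ are continuous functions on $I_r$; an $H$-set is a finite union of $H$-basic sets; a $\Lambda$-set is a bounded set $A\subset\mathbb R^n$ such that for every $a\in\mathbb R^n$ there is a polydisk $I_r$ for which $(A-a)\cap I_r$ is an $H$-set. A sub-quadrant is a product $D_1\times\dots\times D_n$ where each $D_i$ is $\{0\}$, $(0,s_i)$ or $(-s_i,0)$ for some $s_i>0$. An elementary transformation is a map $x'\mapsto x$ from a polydisk $I_{r'}$ to a polydisk $I_r$ in $\mathbb R^n$ of one of the following forms (coordinates not mentioned are unchanged): $x_i=x'_j(\lambda+x'_i)$ with $i\neq j$, $\lambda\in\mathbb R$; $x_n=x'_n+h(x'_1,\dots,x'_{n-1})$ with $n\ge 1$ and $h\in\mathcal A_{n-1}$ a continuous function on $\prod_{i<n}(-r'_i,r'_i)$ with $h(0)=0$; $x_k=x'_k+c_kx'_i$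 for all $k<i$, with $c_1,\dots,c_{i-1}\in\mathbb R$; $x_i=\pm x_i'^{\,d}$ with $d\geq1$. An admissible transformation is a finite (possibly empty) composition of elementary transformations; it fixes $0$. Then for every $n\ge0$ and every $\Lambda$-set $A\subset\mathbb R^n$ there are finitely many points $a_1,\dots,a_p\in\mathbb R^n$, sub-quadrants $Q_1,\dots,Q_p\subset\mathbb R^n$ and admissible transformations $\rho_1,\dots,\rho_p$, with $\rho_i$ defined on $Q_i$, such that $$A=\bigl(a_1+\rho_1(Q_1)\bigr)\cup\dots\cup\bigl(a_p+\rho_p(Q_p)\bigr).$$ Moreover, every $\Lambda$-set has finitely many connected components. -/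

import Mathlib

open Set Filter
open scoped Topology ContDiff

namespace HSets

/-- The polydisk `(-r₁, r₁) × ⋯ × (-rₙ, rₙ)`; it is only used for positive radii. -/
def polydisk {n : ℕ} (r : Fin n → ℝ) : Set (Fin n → ℝ) :=
  {x | ∀ i, -r i < x i ∧ x i < r i}

/-- The germ at `0` of `f` is weakly `C^∞`: for every finite `p`, the function `f` is `C^p` on some
neighbourhood of `0`, which may depend on `p`. This is exactly what Mathlib's pointwise notion
`ContDiffAt` says for the order `∞`. -/
def WeaklySmooth {n : ℕ} (f : (Fin n → ℝ) → ℝ) : Prop :=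
  ContDiffAt ℝ ∞ f 0

/-- `GermAlg H n f` says that the germ of `f` at `0` belongs to the algebra `𝒜ₙ(H)`. The family
`𝒜(H)` is the smallest family of algebras of weakly `C^∞` germs that contains `H` and the
polynomials and is closed under monomial division, composition and implicit functions. Germs are
handled through their representatives, which the constructor `congr` makes interchangeable. -/
inductive GermAlg (H : ℝ → ℝ) : (n : ℕ) → ((Fin n → ℝ) → ℝ) → Prop
  | congr {n : ℕ} {f g : (Fin n → ℝ) → ℝ} :
      GermAlg H n f → f =ᶠ[𝓝 0] g → GermAlg H n g
  | base : GermAlg H 1 (fun x => H (x 0))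
  | poly {n : ℕ} (p : MvPolynomial (Fin n) ℝ) : GermAlg H n (fun x => MvPolynomial.eval x p)
  | sum {n : ℕ} {f g : (Fin n → ℝ) → ℝ} :
      GermAlg H n f → GermAlg H n g → GermAlg H n (fun x => f x + g x)
  | prod {n : ℕ} {f g : (Fin n → ℝ) → ℝ} :
      GermAlg H n f → GermAlg H n g → GermAlg H n (fun x => f x * g x)
  /-- If `f` vanishes on `xᵢ = 0`, the continuous germ `g` extending `f / xᵢ` is in the algebra. -/
  | monomialDiv {n : ℕ} {f g : (Fin n → ℝ) → ℝ} (i : Fin n) :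
      GermAlg H n f →
      (∀ᶠ x in 𝓝 (0 : Fin n → ℝ), x i = 0 → f x = 0) →
      (∀ᶠ x in 𝓝 (0 : Fin n → ℝ), ContinuousAt g x) →
      (∀ᶠ x in 𝓝 (0 : Fin n → ℝ), x i ≠ 0 → g x = f x / x i) →
      GermAlg H n g
  | comp {m n : ℕ} {f : (Fin m → ℝ) → ℝ} {g : Fin m → (Fin n → ℝ) → ℝ} :
      GermAlg H m f → (∀ j, GermAlg H n (g j)) → (∀ j, g j 0 = 0) →
      GermAlg H n (fun x => f (fun j => g j x))
  /-- The weakly `C^∞` solution `φ`, `φ(0) = 0`, of `f(x', φ(x')) = 0` is in the algebra when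
  `f(0) = 0` and the last partial derivative of `f` does not vanish at `0`. -/
  | implicit {n : ℕ} {f : (Fin (n + 1) → ℝ) → ℝ} {φ : (Fin n → ℝ) → ℝ} :
      GermAlg H (n + 1) f → f 0 = 0 → fderiv ℝ f 0 (Pi.single (Fin.last n) 1) ≠ 0 →
      WeaklySmooth φ → φ 0 = 0 →
      (∀ᶠ x in 𝓝 (0 : Fin n → ℝ), f (Fin.snoc (α := fun _ => ℝ) x (φ x)) = 0) →
      GermAlg H n φ

/-- The partial derivative `∂f/∂xᵢ`. -/
noncomputable def partialDeriv {n : ℕ} (i : Fin n) (f : (Fin n → ℝ) → ℝ) : (Fin n → ℝ) → ℝ :=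
  fun x => fderiv ℝ f x (Pi.single i 1)

/-- The iterated partial derivative `∂^{|α|} f / ∂x^α`. -/
noncomputable def iteratedPartialDeriv {n : ℕ} (α : Fin n →₀ ℕ) (f : (Fin n → ℝ) → ℝ) :
    (Fin n → ℝ) → ℝ :=
  (List.finRange n).foldr (fun i g => (partialDeriv i)^[α i] g) f

/-- The Taylor series of `f` at `0`, meaningful when `f` is weakly `C^∞` there. -/
noncomputable def taylorSeries {n : ℕ} (f : (Fin n → ℝ) → ℝ) : MvPowerSeries (Fin n) ℝ :=
  fun α => iteratedPartialDeriv α f 0 / ∏ i, ((α i).factorial : ℝ)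

/-- `H` has a weakly `C^∞` but not `C^∞` germ at `0`, is piecewise given by finitely many
polynomials off any neighbourhood of `0`, and generates quasianalytic algebras. -/
structure IsLeGalRolin (H : ℝ → ℝ) : Prop where
  weaklySmooth : ContDiffAt ℝ ∞ H 0
  not_smooth : ∀ U : Set ℝ, IsOpen U → (0 : ℝ) ∈ U → ¬ ContDiffOn ℝ ∞ H U
  piecewise_polynomial : ∀ U ∈ 𝓝 (0 : ℝ), ∃ (k : ℕ) (I : Fin k → Set ℝ) (P : Fin k → Polynomial ℝ),
    (∀ j, (I j).OrdConnected) ∧ Uᶜ ⊆ ⋃ j, I j ∧ ∀ j, ∀ x ∈ I j \ U, H x = (P j).eval x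
  quasianalytic : ∀ (n : ℕ) (f g : (Fin n → ℝ) → ℝ), GermAlg H n f → GermAlg H n g →
    taylorSeries f = taylorSeries g → f =ᶠ[𝓝 0] g

/-- `f` is a continuous function on the polydisk of radii `r` with germ at `0` in `𝒜ₙ(H)`. -/
def IsAlgFun (H : ℝ → ℝ) {n : ℕ} (r : Fin n → ℝ) (f : (Fin n → ℝ) → ℝ) : Prop :=
  ContinuousOn f (polydisk r) ∧ GermAlg H n f

def IsHBasic (H : ℝ → ℝ) {n : ℕ} (A : Set (Fin n → ℝ)) : Prop :=
  ∃ (r : Fin n → ℝ) (q : ℕ) (g₀ : (Fin n → ℝ) → ℝ) (g : Fin q → (Fin n → ℝ) → ℝ),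
    (∀ i, 0 < r i) ∧ IsAlgFun H r g₀ ∧ (∀ j, IsAlgFun H r (g j)) ∧
    A = {x | x ∈ polydisk r ∧ g₀ x = 0 ∧ ∀ j, 0 < g j x}

/-- A finite union of `H`-basic sets. -/
def IsHSet (H : ℝ → ℝ) {n : ℕ} (A : Set (Fin n → ℝ)) : Prop :=
  ∃ (k : ℕ) (B : Fin k → Set (Fin n → ℝ)), (∀ j, IsHBasic H (B j)) ∧ A = ⋃ j, B j

/-- Around every point `a`, the translate `A - a` is an `H`-set on some polydisk. -/
def IsHSemianalytic (H : ℝ → ℝ) {n : ℕ} (A : Set (Fin n → ℝ)) : Prop :=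
  ∀ a : Fin n → ℝ, ∃ r : Fin n → ℝ, (∀ i, 0 < r i) ∧ IsHSet H ({x | a + x ∈ A} ∩ polydisk r)

def IsLambdaSet (H : ℝ → ℝ) {n : ℕ} (A : Set (Fin n → ℝ)) : Prop :=
  IsHSemianalytic H A ∧ Bornology.IsBounded A

/-- A product of sets each of the form `{0}`, `(0, s)` or `(-s, 0)` with `s > 0`. -/
def IsSubQuadrant {n : ℕ} (Q : Set (Fin n → ℝ)) : Prop :=
  ∃ D : Fin n → Set ℝ,
    (∀ i, D i = {0} ∨ ∃ s : ℝ, 0 < s ∧ (D i = Ioo 0 s ∨ D i = Ioo (-s) 0)) ∧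
    Q = Set.pi univ D

/-- The formulas of the elementary transformations with domain the polydisk of radii `r'`. The
blow-up chart `π_{i,j}^∞` is `π_{j,i}^0`, so it needs no constructor of its own. -/
inductive ElementaryFormula (H : ℝ → ℝ) :
    (n : ℕ) → (r' : Fin n → ℝ) → ((Fin n → ℝ) → (Fin n → ℝ)) → Prop
  | blowUp {n : ℕ} {r' : Fin n → ℝ} (i j : Fin n) (hij : i ≠ j) (c : ℝ) :
      ElementaryFormula H n r' (fun x => Function.update x i (x j * (c + x i)))
  | tschirnhausen {m : ℕ} {r' : Fin (m + 1) → ℝ} (h : (Fin m → ℝ) → ℝ)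
      (hh : IsAlgFun H (fun k => r' k.castSucc) h) (h_zero : h 0 = 0) :
      ElementaryFormula H (m + 1) r'
        (fun x => Function.update x (Fin.last m) (x (Fin.last m) + h (fun k => x k.castSucc)))
  | shear {n : ℕ} {r' : Fin n → ℝ} (i : Fin n) (c : Fin n → ℝ) :
      ElementaryFormula H n r' (fun x k => if k < i then x k + c k * x i else x k)
  | ramification {n : ℕ} {r' : Fin n → ℝ} (i : Fin n) (d : ℕ) (hd : 0 < d) (ε : ℝ)
      (hε : ε = 1 ∨ ε = -1) :
      ElementaryFormula H n r' (fun x => Function.update x i (ε * x i ^ d))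

/-- `ν` is an elementary transformation from the polydisk of radii `r'` to that of radii `r`. -/
def IsElementary (H : ℝ → ℝ) {n : ℕ} (r' r : Fin n → ℝ) (ν : (Fin n → ℝ) → (Fin n → ℝ)) : Prop :=
  (∀ i, 0 < r' i) ∧ (∀ i, 0 < r i) ∧ MapsTo ν (polydisk r') (polydisk r) ∧
    ElementaryFormula H n r' ν

/-- `ρ` is an admissible transformation from the polydisk of radii `r'` to that of radii `r`: a
finite (possibly empty) composition of elementary transformations. -/
inductive IsAdmissible (H : ℝ → ℝ) {n : ℕ} :
    (r' r : Fin n → ℝ) → ((Fin n → ℝ) → (Fin n → ℝ)) → Prop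
  | refl {r : Fin n → ℝ} : (∀ i, 0 < r i) → IsAdmissible H r r id
  | comp {r'' r' r : Fin n → ℝ} {ν ρ : (Fin n → ℝ) → (Fin n → ℝ)} :
      IsElementary H r' r ν → IsAdmissible H r'' r' ρ → IsAdmissible H r'' r (ν ∘ ρ)

/-- `ρ` is an admissible transformation whose domain contains `Q`. -/
def IsAdmissibleOn (H : ℝ → ℝ) {n : ℕ} (Q : Set (Fin n → ℝ))
    (ρ : (Fin n → ℝ) → (Fin n → ℝ)) : Prop :=
  ∃ r' r : Fin n → ℝ, IsAdmissible H r' r ρ ∧ Q ⊆ polydisk r'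

end HSets

/-!
A bounded set that is locally an `H`-set is covered, by compactness, by finitely many
neighbourhoods of points, so everything happens at the level of germs: it suffices that for
finitely many germs of the algebra `𝒜ₙ(H)` a neighbourhood of `0` is a finite union of images of
sub-quadrants under admissible transformations, each germ having constant sign on each image
(`HSets.uniformizable`). Images of sub-quadrants are connected, which bounds the number of
connected components.

Monomials times units have constant sign on small sub-quadrants, so the core is local
monomialization (`HSets.GermAlg.normalizable`): every nonzero germ becomes a monomial times a unit
after finitely many translations of one variable, blow-ups and ramifications. For a finite family
one monomializes the product of its nonzero members, since a divisor of a monomial times a unit is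
of the same kind (`HSets.IsMonomialUnit.of_mul`).

The algebra is stable under the operations this requires. Hadamard's integral formula shows that
division by a coordinate preserves smoothness, hence that `𝒜ₙ(H)` consists of weakly smooth germs
and contains the derivatives of its members. Quasianalyticity says that a nonzero germ is not
divisible by all powers of a coordinate; induction on `n` then makes `𝒜ₙ(H)` a domain and provides
a curve `(t ^ N₁, …, t ^ Nₙ, t)` along which a given nonzero germ does not vanish
identically, so that after a translation it is regular of some order `d` in the last variable `t`.

Monomialization is proved by induction on the number of variables and on `d`. With `e = d - 1`,
the implicit equation `∂ᵉf/∂tᵉ = 0` provides a translation of `t` after which `f` has the form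
`∑_{i < e} aᵢ tⁱ + tᵈ u`, the `aᵢ` depending on the other variables and `u` being a unit. The sum
`S` of suitable even powers of the `aᵢ` involves fewer variables, so it may be assumed to be a
monomial times a unit. As real numbers, each of these powers is bounded by `S`, and a germ bounded
by a monomial is divisible by it (`HSets.GermAlg.exists_eq_monomial_mul`); hence after a
ramification `aᵢ = x^{(d - i)β} bᵢ` with at least one unit among the `bᵢ`. Each blow-up of `t =
x_l = 0` with `β_l > 0` divides `f` by `x_l ^ d` and decreases `β_l`, except in the charts where
`f` becomes regular of order less than `d` or a monomial times a unit; when `β = 0` the order of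
`f` is less than `d` (`HSets.normalizable_of_prepared`).

Translations of a variable other than the last one are admissible because exchanging two variables
is, up to a sign, a composition of three unipotent linear maps (`HSets.Uniformizable.swap_last`).
-/

namespace HSets

open Function MeasureTheory

variable {H : ℝ → ℝ}

/-! ### Smoothness of the quotient by a coordinate -/

theorem weaklySmooth_iff {n : ℕ} {f : (Fin n → ℝ) → ℝ} :
    WeaklySmooth f ↔ ∀ p : ℕ, ContDiffAt ℝ p f 0 := contDiffAt_infty

theorem WeaklySmooth.eventually {n : ℕ} {f : (Fin n → ℝ) → ℝ} (hf : WeaklySmooth f) (p : ℕ) :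
    ∀ᶠ x in 𝓝 (0 : Fin n → ℝ), ContDiffAt ℝ p f x :=
  (weaklySmooth_iff.1 hf p).eventually (by simp)

theorem WeaklySmooth.eventually_differentiableAt {n : ℕ} {f : (Fin n → ℝ) → ℝ}
    (hf : WeaklySmooth f) : ∀ᶠ x in 𝓝 (0 : Fin n → ℝ), DifferentiableAt ℝ f x :=
  (hf.eventually 1).mono fun _ hx => hx.differentiableAt (by simp)

theorem WeaklySmooth.eventually_continuousAt {n : ℕ} {f : (Fin n → ℝ) → ℝ}
    (hf : WeaklySmooth f) : ∀ᶠ x in 𝓝 (0 : Fin n → ℝ), ContinuousAt f x :=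
  hf.eventually_differentiableAt.mono fun _ hx => hx.continuousAt

theorem WeaklySmooth.partialDeriv {n : ℕ} {f : (Fin n → ℝ) → ℝ} (hf : WeaklySmooth f)
    (i : Fin n) : WeaklySmooth (partialDeriv i f) := by
  have h : ContDiffAt ℝ ∞ (fderiv ℝ f) 0 := ContDiffAt.fderiv_right hf (by norm_cast)
  exact h.clm_apply contDiffAt_const

/-- The quotient `(f(x) - f(x)|_{xᵢ = 0}) / xᵢ`, in the integral form that makes sense, and is
smooth, on the hyperplane `xᵢ = 0` as well. -/
noncomputable def hadamardQuotient {n : ℕ} (i : Fin n) (f : (Fin n → ℝ) → ℝ) :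
    (Fin n → ℝ) → ℝ :=
  fun x => ∫ s in (0 : ℝ)..1, partialDeriv i f (update x i (s * x i))

theorem hadamardQuotient_of_eq_zero {n : ℕ} (i : Fin n) (f : (Fin n → ℝ) → ℝ) {x : Fin n → ℝ}
    (hx : x i = 0) : hadamardQuotient i f x = partialDeriv i f x := by
  have : ∀ s : ℝ, update x i (s * x i) = x := fun s => by
    rw [hx, mul_zero, ← hx, update_eq_self]
  simp [hadamardQuotient, this]

theorem norm_update_mul_le {n : ℕ} (i : Fin n) (x : Fin n → ℝ) {s c : ℝ} (hs : |s| ≤ c)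
    (hc : 1 ≤ c) : ‖update x i (s * x i)‖ ≤ c * ‖x‖ := by
  refine (pi_norm_le_iff_of_nonneg (by positivity)).2 fun j => ?_
  have hj := norm_le_pi_norm x j
  by_cases h : j = i
  · subst h
    rw [update_self, norm_mul]
    exact mul_le_mul hs hj (norm_nonneg _) (by linarith)
  · rw [update_of_ne h]
    nlinarith [norm_nonneg x]

theorem WeaklySmooth.eq_add_mul_hadamardQuotient {n : ℕ} {f : (Fin n → ℝ) → ℝ}
    (hf : WeaklySmooth f) (i : Fin n) :
    ∀ᶠ x in 𝓝 (0 : Fin n → ℝ), f x = f (update x i 0) + x i * hadamardQuotient i f x := by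
  obtain ⟨ε, hε, hb⟩ := Metric.eventually_nhds_iff_ball.1 (hf.eventually 1)
  filter_upwards [Metric.ball_mem_nhds 0 hε] with x hx
  have hmem : ∀ s ∈ uIcc (0 : ℝ) 1, ContDiffAt ℝ 1 f (update x i (s * x i)) := by
    intro s hs
    rw [uIcc_of_le zero_le_one] at hs
    refine hb _ ?_
    have := norm_update_mul_le i x (s := s) (abs_le.2 ⟨by linarith [hs.1], hs.2⟩) le_rfl
    simp only [mem_ball_zero_iff] at hx ⊢
    linarith
  have hd : ∀ s ∈ uIcc (0 : ℝ) 1, HasDerivAt (fun s => f (update x i (s * x i)))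
      (x i * HSets.partialDeriv i f (update x i (s * x i))) s := by
    intro s hs
    have h1 := ((hmem s hs).differentiableAt (by simp)).hasFDerivAt
    have h2 : HasDerivAt (fun s => update x i (s * x i)) (Pi.single i (x i)) s := by
      rw [hasDerivAt_pi]
      intro j
      by_cases h : j = i
      · subst h; simpa using hasDerivAt_mul_const (x j)
      · simpa [update_of_ne h, Pi.single_eq_of_ne h] using hasDerivAt_const s (x j)
    have h3 := h1.comp_hasDerivAt s h2
    convert! h3 using 1
    have : (Pi.single i (x i) : Fin n → ℝ) = x i • Pi.single i 1 := by
      rw [← Pi.single_smul]; simp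
    rw [this, map_smul, smul_eq_mul]; rfl
  have hc : ContinuousOn (fun s => x i * HSets.partialDeriv i f (update x i (s * x i)))
      (uIcc (0 : ℝ) 1) := by
    intro s hs
    have h1 : ContinuousAt (fderiv ℝ f) (update x i (s * x i)) :=
      ((hmem s hs).fderiv_right (m := 0) (by simp)).continuousAt
    have h2 : ContinuousAt (fun s : ℝ => update x i (s * x i)) s := by fun_prop
    have h3 : ContinuousAt (fun s => fderiv ℝ f (update x i (s * x i))) s :=
      ContinuousAt.comp (f := fun s : ℝ => update x i (s * x i)) h1 h2
    exact (continuousAt_const.mul (h3.clm_apply continuousAt_const)).continuousWithinAt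
  have := intervalIntegral.integral_eq_sub_of_hasDerivAt hd (hc.intervalIntegrable)
  rw [intervalIntegral.integral_const_mul] at this
  simp only [one_mul, zero_mul, update_eq_self] at this
  unfold hadamardQuotient
  linarith

open scoped Convolution in
theorem WeaklySmooth.hadamardQuotient {n : ℕ} {f : (Fin n → ℝ) → ℝ} (hf : WeaklySmooth f)
    (i : Fin n) : WeaklySmooth (hadamardQuotient i f) := by
  refine weaklySmooth_iff.2 fun p => ?_
  obtain ⟨ε, hε, hb⟩ := Metric.eventually_nhds_iff_ball.1 ((hf.partialDeriv i).eventually p)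
  -- The integral is a convolution, in the variable `s`, of the indicator function of `(0, 1]` with
  -- the integrand cut off by a bump function equal to `1` for `|s| ≤ 1`.
  let χ : ContDiffBump (0 : ℝ) := ⟨1, 2, by norm_num, by norm_num⟩
  let g : (Fin n → ℝ) → ℝ → ℝ := fun x y =>
    χ y * HSets.partialDeriv i f (update x i (-y * x i))
  have hmaps : ∀ x ∈ Metric.ball (0 : Fin n → ℝ) (ε / 3), ∀ y : ℝ, |y| ≤ 3 →
      update x i (y * x i) ∈ Metric.ball (0 : Fin n → ℝ) ε := by
    intro x hx y hy
    have := norm_update_mul_le i x hy (by norm_num)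
    simp only [mem_ball_zero_iff] at hx ⊢
    linarith
  have key : ContDiffOn ℝ p (fun x => ((indicator (Ioc (0 : ℝ) 1) (fun _ => (1 : ℝ)))
      ⋆[ContinuousLinearMap.mul ℝ ℝ, volume] g x) 0) (Metric.ball (0 : Fin n → ℝ) (ε / 3)) := by
    refine contDiffOn_convolution_right_with_param_comp (n := p) (ContinuousLinearMap.mul ℝ ℝ)
      (v := fun _ => (0 : ℝ))
      contDiffOn_const Metric.isOpen_ball (isCompact_closedBall (0 : ℝ) 2) ?_ ?_ ?_
    · intro x y _ hy
      have : χ y = 0 := χ.zero_of_le_dist (by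
        simp only [Metric.mem_closedBall, not_le] at hy
        exact hy.le)
      simp [g, this]
    · exact ((integrable_indicator_iff measurableSet_Ioc).2
        (integrableOn_const (by simp))).locallyIntegrable
    · rintro ⟨x, y⟩ ⟨hx, -⟩
      refine ContDiffAt.contDiffWithinAt ?_
      by_cases hy : |y| < 3
      · have h1 : ContDiffAt ℝ p (HSets.partialDeriv i f) (update x i (-y * x i)) :=
          hb _ (hmaps x hx _ (by simpa using hy.le))
        have h2 : ContDiffAt ℝ p (fun q : (Fin n → ℝ) × ℝ => update q.1 i (-q.2 * q.1 i))
            (x, y) := by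
          refine contDiffAt_pi.2 fun j => ?_
          by_cases h : j = i
          · subst h
            simp only [update_self]
            fun_prop
          · simp only [update_of_ne h]
            fun_prop
        have h3 := ContDiffAt.comp (x, y) (f := fun q : (Fin n → ℝ) × ℝ =>
          update q.1 i (-q.2 * q.1 i)) h1 h2
        exact (χ.contDiff.comp contDiff_snd).contDiffAt.mul h3
      · have : (uncurry g) =ᶠ[𝓝 (x, y)] fun _ => 0 := by
          have h : ∀ᶠ q : (Fin n → ℝ) × ℝ in 𝓝 (x, y), 2 < |q.2| := by
            have hc : Continuous fun q : (Fin n → ℝ) × ℝ => |q.2| := by fun_prop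
            exact hc.continuousAt.eventually (lt_mem_nhds (by simp at hy ⊢; linarith))
          filter_upwards [h] with q hq
          have : χ q.2 = 0 := χ.zero_of_le_dist (by simpa [χ] using hq.le)
          simp [uncurry, g, this]
        exact contDiffAt_const.congr_of_eventuallyEq this
  refine (key.contDiffAt (Metric.ball_mem_nhds _ (by positivity))).congr_of_eventuallyEq ?_
  refine Eventually.of_forall fun x => ?_
  simp only [HSets.hadamardQuotient, convolution]
  rw [intervalIntegral.integral_of_le zero_le_one, ← integral_indicator measurableSet_Ioc]
  congr 1
  ext t
  by_cases ht : t ∈ Ioc (0 : ℝ) 1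
  · have : χ (-t) = 1 := χ.one_of_mem_closedBall (by
      simp only [Metric.mem_closedBall, dist_zero_right, norm_neg, Real.norm_eq_abs, χ]
      exact abs_le.2 ⟨by linarith [ht.1], ht.2⟩)
    simp [ht, g, this]
  · simp [ht]

/-! ### Closure properties of the algebras -/

theorem dense_coord_ne_zero {n : ℕ} (i : Fin n) : Dense {x : Fin n → ℝ | x i ≠ 0} :=
  (dense_compl_singleton (0 : ℝ)).preimage (isOpenMap_eval i)

/-- Two functions continuous near `0` that agree off the hyperplane `xᵢ = 0` have the same germ. -/
theorem eventuallyEq_of_coord_ne_zero {n : ℕ} {f g : (Fin n → ℝ) → ℝ} (i : Fin n)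
    (hf : ∀ᶠ x in 𝓝 (0 : Fin n → ℝ), ContinuousAt f x)
    (hg : ∀ᶠ x in 𝓝 (0 : Fin n → ℝ), ContinuousAt g x)
    (h : ∀ᶠ x in 𝓝 (0 : Fin n → ℝ), x i ≠ 0 → f x = g x) : f =ᶠ[𝓝 0] g := by
  filter_upwards [hf, hg, h.eventually_nhds] with x hfx hgx hx
  refine tendsto_nhds_unique_of_frequently_eq hfx hgx ?_
  exact (((dense_coord_ne_zero i) x |> mem_closure_iff_frequently.1).and_eventually hx).mono
    fun y hy => hy.2 hy.1

theorem hasDerivAt_comp_update {n : ℕ} {f : (Fin n → ℝ) → ℝ} {x : Fin n → ℝ} (i : Fin n)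
    (hf : DifferentiableAt ℝ f x) :
    HasDerivAt (fun s => f (update x i s)) (partialDeriv i f x) (x i) := by
  have h := hasDerivAt_update x i (x i)
  have hf' : HasFDerivAt f (fderiv ℝ f x) (update x i (x i)) := by
    rw [update_eq_self]; exact hf.hasFDerivAt
  exact hf'.comp_hasDerivAt (x i) h

theorem GermAlg.weaklySmooth (hH : IsLeGalRolin H) {n : ℕ} {f : (Fin n → ℝ) → ℝ}
    (hf : GermAlg H n f) : WeaklySmooth f := by
  induction hf with
  | congr _ h ih => exact ih.congr_of_eventuallyEq h.symm
  | base =>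
    have h : ContDiffAt ℝ ∞ H ((fun x : Fin 1 → ℝ => x 0) 0) := hH.weaklySmooth
    exact h.comp (0 : Fin 1 → ℝ) (f := fun x => x 0) (contDiffAt_apply _ _ _ _)
  | poly p =>
    refine ContDiff.contDiffAt ?_
    induction p using MvPolynomial.induction_on with
    | C a => simpa using contDiff_const
    | add p q hp hq => simpa using hp.add hq
    | mul_X p i hp => simpa using hp.mul (contDiff_apply ℝ ℝ i)
  | sum _ _ h₁ h₂ => exact ContDiffAt.add h₁ h₂
  | prod _ _ h₁ h₂ => exact ContDiffAt.mul h₁ h₂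
  | @monomialDiv n f g i _ h₀ hg hfg ih =>
    refine (WeaklySmooth.hadamardQuotient ih i).congr_of_eventuallyEq ?_
    refine eventuallyEq_of_coord_ne_zero i hg
      (WeaklySmooth.hadamardQuotient ih i).eventually_continuousAt ?_
    have hz : Tendsto (fun x : Fin n → ℝ => update x i 0) (𝓝 0) (𝓝 0) := by
      have : Continuous (fun x : Fin n → ℝ => update x i 0) := by fun_prop
      simpa using this.tendsto 0
    filter_upwards [hfg, WeaklySmooth.eq_add_mul_hadamardQuotient ih i, hz.eventually h₀]
      with x h1 h2 h3 hx
    rw [h1 hx, h2, h3 (by simp)]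
    field_simp
    ring
  | @comp m n f g _ _ h₀ ih₁ ih₂ =>
    have h : (fun j => g j 0) = 0 := funext h₀
    have ih₁' : ContDiffAt ℝ ∞ f ((fun x j => g j x) 0) := by simpa [h] using! ih₁
    exact ih₁'.comp (0 : Fin n → ℝ) (f := fun x j => g j x) (contDiffAt_pi.2 ih₂)
  | implicit _ _ _ hφ _ _ _ => exact hφ

namespace GermAlg

variable {n m : ℕ} {f g : (Fin n → ℝ) → ℝ}

theorem eventually_continuousAt (hH : IsLeGalRolin H) (hf : GermAlg H n f) :
    ∀ᶠ x in 𝓝 (0 : Fin n → ℝ), ContinuousAt f x :=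
  (hf.weaklySmooth hH).eventually_continuousAt

theorem continuousAt (hH : IsLeGalRolin H) (hf : GermAlg H n f) : ContinuousAt f 0 :=
  (hf.eventually_continuousAt hH).self_of_nhds

theorem const (n : ℕ) (c : ℝ) : GermAlg H n fun _ => c := by
  simpa using poly (H := H) (MvPolynomial.C c : MvPolynomial (Fin n) ℝ)

theorem coord (i : Fin n) : GermAlg H n fun x => x i := by
  simpa using poly (H := H) (MvPolynomial.X i : MvPolynomial (Fin n) ℝ)

theorem const_mul (c : ℝ) (hf : GermAlg H n f) : GermAlg H n fun x => c * f x :=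
  (const n c).prod hf

theorem neg (hf : GermAlg H n f) : GermAlg H n fun x => -f x := by
  simpa using hf.const_mul (-1)

theorem sub (hf : GermAlg H n f) (hg : GermAlg H n g) : GermAlg H n fun x => f x - g x := by
  simpa [sub_eq_add_neg] using hf.sum hg.neg

theorem pow (hf : GermAlg H n f) (k : ℕ) : GermAlg H n fun x => f x ^ k := by
  induction k with
  | zero => simpa using const n 1
  | succ k ih => simpa [pow_succ] using ih.prod hf

theorem finset_sum {ι : Type*} (s : Finset ι) {f : ι → (Fin n → ℝ) → ℝ}
    (hf : ∀ i ∈ s, GermAlg H n (f i)) : GermAlg H n fun x => ∑ i ∈ s, f i x := by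
  classical
  induction s using Finset.induction_on with
  | empty => simpa using const n 0
  | insert a s ha ih =>
    simp only [Finset.sum_insert ha]
    exact (hf a (by simp)).sum (ih fun i hi => hf i (by simp [hi]))

theorem finset_prod {ι : Type*} (s : Finset ι) {f : ι → (Fin n → ℝ) → ℝ}
    (hf : ∀ i ∈ s, GermAlg H n (f i)) : GermAlg H n fun x => ∏ i ∈ s, f i x := by
  classical
  induction s using Finset.induction_on with
  | empty => simpa using const n 1
  | insert a s ha ih =>
    simp only [Finset.prod_insert ha]
    exact (hf a (by simp)).prod (ih fun i hi => hf i (by simp [hi]))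

end GermAlg

/-- A germ of map fixing `0` whose components belong to the algebra `𝒜ₙ(H)`. -/
def IsAlgMap (H : ℝ → ℝ) {n m : ℕ} (ρ : (Fin n → ℝ) → (Fin m → ℝ)) : Prop :=
  (∀ j, GermAlg H n fun x => ρ x j) ∧ ρ 0 = 0

theorem GermAlg.comp_map {n m : ℕ} {f : (Fin m → ℝ) → ℝ} {ρ : (Fin n → ℝ) → (Fin m → ℝ)}
    (hf : GermAlg H m f) (hρ : IsAlgMap H ρ) : GermAlg H n fun x => f (ρ x) :=
  GermAlg.comp hf hρ.1 fun j => congrFun hρ.2 j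

namespace IsAlgMap

variable {n m k : ℕ} {ρ : (Fin n → ℝ) → (Fin m → ℝ)}

theorem tendsto (hH : IsLeGalRolin H) (hρ : IsAlgMap H ρ) : Tendsto ρ (𝓝 0) (𝓝 0) := by
  rw [tendsto_pi_nhds]
  intro j
  have h := (hρ.1 j).continuousAt hH
  have h0 : ρ 0 j = 0 := congrFun hρ.2 j
  simpa [ContinuousAt, h0] using h

theorem comp {σ : (Fin k → ℝ) → (Fin n → ℝ)} (hρ : IsAlgMap H ρ) (hσ : IsAlgMap H σ) :
    IsAlgMap H fun x => ρ (σ x) :=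
  ⟨fun j => (hρ.1 j).comp_map hσ, by beta_reduce; rw [hσ.2, hρ.2]⟩

theorem id : IsAlgMap H fun x : Fin n → ℝ => x := ⟨fun j => GermAlg.coord j, rfl⟩

theorem update (hρ : IsAlgMap H ρ) (i : Fin m) {h : (Fin n → ℝ) → ℝ} (hh : GermAlg H n h)
    (h0 : h 0 = 0) : IsAlgMap H fun x => update (ρ x) i (h x) := by
  refine ⟨fun j => ?_, ?_⟩
  · by_cases hj : j = i
    · subst hj; simpa using hh
    · simpa [update_of_ne hj] using hρ.1 j
  · beta_reduce
    rw [hρ.2, h0]; simp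

theorem snoc (hρ : IsAlgMap H ρ) {h : (Fin n → ℝ) → ℝ} (hh : GermAlg H n h) (h0 : h 0 = 0) :
    IsAlgMap H fun x => (Fin.snoc (α := fun _ => ℝ) (ρ x) (h x) : Fin (m + 1) → ℝ) := by
  refine ⟨fun j => ?_, ?_⟩
  · refine Fin.lastCases ?_ (fun j => ?_) j
    · simpa using hh
    · simpa using hρ.1 j
  · beta_reduce
    rw [hρ.2, h0]
    ext j
    refine Fin.lastCases ?_ (fun j => ?_) j <;> simp

theorem cons (hρ : IsAlgMap H ρ) {h : (Fin n → ℝ) → ℝ} (hh : GermAlg H n h) (h0 : h 0 = 0) :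
    IsAlgMap H fun x => (Fin.cons (α := fun _ => ℝ) (h x) (ρ x) : Fin (m + 1) → ℝ) := by
  refine ⟨fun j => ?_, ?_⟩
  · refine Fin.cases ?_ (fun j => ?_) j
    · simpa using hh
    · simpa using hρ.1 j
  · beta_reduce
    rw [hρ.2, h0]
    ext j
    refine Fin.cases ?_ (fun j => ?_) j <;> simp

theorem init : IsAlgMap H fun x : Fin (n + 1) → ℝ => (Fin.init x : Fin n → ℝ) :=
  ⟨fun j => by simpa [Fin.init] using GermAlg.coord j.castSucc, rfl⟩

theorem snoc_zero : IsAlgMap H fun x : Fin n → ℝ =>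
    (Fin.snoc (α := fun _ => ℝ) x 0 : Fin (n + 1) → ℝ) :=
  IsAlgMap.id.snoc (GermAlg.const n 0) rfl

theorem cons_zero : IsAlgMap H fun x : Fin n → ℝ =>
    (Fin.cons (α := fun _ => ℝ) 0 x : Fin (n + 1) → ℝ) :=
  IsAlgMap.id.cons (GermAlg.const n 0) rfl

theorem update_zero (i : Fin n) : IsAlgMap H fun x : Fin n → ℝ => Function.update x i 0 :=
  IsAlgMap.id.update i (GermAlg.const n 0) rfl

end IsAlgMap

theorem _root_.Filter.EventuallyEq.comp_algMap (hH : IsLeGalRolin H) {n m : ℕ}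
    {f g : (Fin m → ℝ) → ℝ} {ρ : (Fin n → ℝ) → (Fin m → ℝ)} (h : f =ᶠ[𝓝 0] g)
    (hρ : IsAlgMap H ρ) : (fun x => f (ρ x)) =ᶠ[𝓝 0] fun x => g (ρ x) :=
  h.comp_tendsto (hρ.tendsto hH)

namespace GermAlg

variable {n m : ℕ} {f g : (Fin n → ℝ) → ℝ}

theorem eventuallyEq_of_coord_ne_zero (hH : IsLeGalRolin H) (hf : GermAlg H n f)
    (hg : GermAlg H n g) (i : Fin n)
    (h : ∀ᶠ x in 𝓝 (0 : Fin n → ℝ), x i ≠ 0 → f x = g x) : f =ᶠ[𝓝 0] g :=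
  HSets.eventuallyEq_of_coord_ne_zero i (hf.eventually_continuousAt hH)
    (hg.eventually_continuousAt hH) h

theorem hadamardQuotient (hH : IsLeGalRolin H) (hf : GermAlg H n f) (i : Fin n) :
    GermAlg H n (hadamardQuotient i f) := by
  have h := (hf.weaklySmooth hH)
  have hF := hf.sub (hf.comp_map (IsAlgMap.update_zero i))
  refine monomialDiv i hF (Eventually.of_forall fun x hx => ?_)
    (h.hadamardQuotient i).eventually_continuousAt ?_
  · rw [show update x i 0 = x by rw [← hx, update_eq_self], sub_self]
  · filter_upwards [h.eq_add_mul_hadamardQuotient i] with x hx hxi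
    rw [eq_div_iff hxi]
    linarith

/-- A germ vanishing on `xᵢ = 0` is divisible by `xᵢ` in the algebra. -/
theorem exists_eq_coord_mul (hH : IsLeGalRolin H) (hf : GermAlg H n f) (i : Fin n)
    (h : ∀ᶠ x in 𝓝 (0 : Fin n → ℝ), f (update x i 0) = 0) :
    ∃ g, GermAlg H n g ∧ f =ᶠ[𝓝 0] fun x => x i * g x := by
  refine ⟨_, hf.hadamardQuotient hH i, ?_⟩
  filter_upwards [(hf.weaklySmooth hH).eq_add_mul_hadamardQuotient i, h] with x h1 h2
  rw [h1, h2, zero_add]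

theorem partialDeriv (hH : IsLeGalRolin H) (hf : GermAlg H n f) (i : Fin n) :
    GermAlg H n (partialDeriv i f) := by
  -- The derivative is the value at `s = 0` of the difference quotient `(f(x + s eᵢ) - f(x)) / s`.
  have hτ : IsAlgMap H fun z : Fin (n + 1) → ℝ =>
      Function.update (Fin.init z : Fin n → ℝ) i (z i.castSucc + z (Fin.last n)) :=
    IsAlgMap.init.update i ((coord _).sum (coord _)) (by simp)
  have hF := hf.comp_map hτ
  have hQ := (hF.hadamardQuotient hH (Fin.last n)).comp_map IsAlgMap.snoc_zero
  refine hQ.congr ?_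
  have h2 := (IsAlgMap.snoc_zero (H := H)).tendsto hH |>.eventually
    (hF.weaklySmooth hH).eventually_differentiableAt
  filter_upwards [(hf.weaklySmooth hH).eventually_differentiableAt, h2] with x h1 h2
  rw [hadamardQuotient_of_eq_zero _ _ (by simp)]
  have h3 := hasDerivAt_comp_update (Fin.last n) h2
  simp only [Fin.init_update_last, Fin.init_snoc, Fin.snoc_last, update_self,
    update_of_ne (Fin.castSucc_lt_last i).ne, Fin.snoc_castSucc] at h3
  have h4 := (hasDerivAt_comp_update i h1)
  have h5 : HasDerivAt (fun s => f (update x i (x i + s))) (HSets.partialDeriv i f x) 0 := by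
    have h6 : HasDerivAt (fun s => f (update x i s)) (HSets.partialDeriv i f x) (x i + 0) := by
      simpa using h4
    simpa using h6.comp_const_add (x i) 0
  exact h3.unique h5

theorem iterate_partialDeriv (hH : IsLeGalRolin H) (hf : GermAlg H n f) (i : Fin n) (k : ℕ) :
    GermAlg H n ((HSets.partialDeriv i)^[k] f) := by
  induction k with
  | zero => exact hf
  | succ k ih => rw [iterate_succ_apply']; exact ih.partialDeriv hH i

end GermAlg

/-! ### Quasianalyticity: orders of vanishing and the absence of zero divisors -/

theorem partialDeriv_congr {n : ℕ} {f g : (Fin n → ℝ) → ℝ} (i : Fin n) (h : f =ᶠ[𝓝 0] g) :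
    partialDeriv i f =ᶠ[𝓝 0] partialDeriv i g :=
  (h.fderiv (𝕜 := ℝ)).mono fun x hx => by simp only [partialDeriv, hx]

theorem partialDeriv_mul {n : ℕ} {f g : (Fin n → ℝ) → ℝ} (i : Fin n) {x : Fin n → ℝ}
    (hf : DifferentiableAt ℝ f x) (hg : DifferentiableAt ℝ g x) :
    partialDeriv i (fun x => f x * g x) x =
      f x * partialDeriv i g x + g x * partialDeriv i f x := by
  simp [partialDeriv, fderiv_fun_mul hf hg]

theorem partialDeriv_coord_pow {n : ℕ} (i j : Fin n) (k : ℕ) (x : Fin n → ℝ) :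
    partialDeriv j (fun x => x i ^ (k + 1)) x =
      x i ^ k * ((k + 1) * (Pi.single j (1 : ℝ) : Fin n → ℝ) i) := by
  have h : HasFDerivAt (fun x : Fin n → ℝ => x i)
      (ContinuousLinearMap.proj i : (Fin n → ℝ) →L[ℝ] ℝ) x := hasFDerivAt_apply i x
  rw [partialDeriv, (h.pow (k + 1)).fderiv]
  simp
  ring

/-- All derivatives at `0` of a germ divisible by every power of a coordinate vanish. -/
theorem iteratedPartialDeriv_eq_zero_of_forall_pow_dvd {n : ℕ} {f : (Fin n → ℝ) → ℝ} (i : Fin n)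
    (hf : ∀ k : ℕ, ∃ g, WeaklySmooth g ∧ f =ᶠ[𝓝 0] fun x => x i ^ k * g x) (α : Fin n →₀ ℕ) :
    iteratedPartialDeriv α f 0 = 0 := by
  let P : ((Fin n → ℝ) → ℝ) → Prop := fun f =>
    ∀ k : ℕ, ∃ g, WeaklySmooth g ∧ f =ᶠ[𝓝 0] fun x => x i ^ k * g x
  have hP : ∀ f, P f → ∀ j, P (partialDeriv j f) := by
    intro f hf j k
    obtain ⟨g, hg, hfg⟩ := hf (k + 1)
    refine ⟨fun x => x i * partialDeriv j g x +
      g x * ((k + 1) * (Pi.single j (1 : ℝ) : Fin n → ℝ) i), ?_, ?_⟩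
    · have h1 : WeaklySmooth fun x : Fin n → ℝ => x i := contDiffAt_apply _ _ _ _
      exact ContDiffAt.add (ContDiffAt.mul h1 (hg.partialDeriv j))
        (ContDiffAt.mul hg contDiffAt_const)
    · refine (partialDeriv_congr j hfg).trans ?_
      filter_upwards [hg.eventually_differentiableAt] with x hx
      rw [partialDeriv_mul j (by fun_prop) hx, partialDeriv_coord_pow]
      ring
  have hP' : ∀ f, P f → ∀ j k, P ((partialDeriv j)^[k] f) := by
    intro f hf j k
    induction k with
    | zero => exact hf
    | succ k ih => rw [iterate_succ_apply']; exact hP _ ih j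
  have hl : ∀ l : List (Fin n), P (l.foldr (fun i g => (partialDeriv i)^[α i] g) f) := by
    intro l
    induction l with
    | nil => exact hf
    | cons a l ih => exact hP' _ ih a _
  obtain ⟨g, -, hfg⟩ := hl (List.finRange n) 1
  have := hfg.eq_of_nhds
  simpa [iteratedPartialDeriv] using this

namespace GermAlg

variable {n m : ℕ} {f g : (Fin n → ℝ) → ℝ}

theorem eventuallyEq_zero_of_forall_pow_dvd (hH : IsLeGalRolin H) (hf : GermAlg H n f) (i : Fin n)
    (h : ∀ k : ℕ, ∃ g, GermAlg H n g ∧ f =ᶠ[𝓝 0] fun x => x i ^ k * g x) :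
    f =ᶠ[𝓝 0] fun _ => 0 := by
  refine hH.quasianalytic n f (fun _ => 0) hf (const n 0) ?_
  funext α
  have h1 := iteratedPartialDeriv_eq_zero_of_forall_pow_dvd i
    (fun k => (h k).imp fun g hg => ⟨hg.1.weaklySmooth hH, hg.2⟩) α
  have h2 := iteratedPartialDeriv_eq_zero_of_forall_pow_dvd (f := fun _ => 0) i
    (fun k => ⟨fun _ => 0, contDiffAt_const, by simp⟩) α
  simp only [taylorSeries, h1, h2]

/-- A nonzero germ of the algebra is the product of a power of `xᵢ` and a germ that does not vanish
identically on `xᵢ = 0`. -/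
theorem exists_eq_coord_pow_mul (hH : IsLeGalRolin H) (hf : GermAlg H n f)
    (h0 : ¬ f =ᶠ[𝓝 0] fun _ => 0) (i : Fin n) :
    ∃ (k : ℕ) (g : (Fin n → ℝ) → ℝ), GermAlg H n g ∧ (f =ᶠ[𝓝 0] fun x => x i ^ k * g x) ∧
      ¬ (fun x => g (update x i 0)) =ᶠ[𝓝 0] fun _ => 0 := by
  by_contra! hcon
  refine h0 (hf.eventuallyEq_zero_of_forall_pow_dvd hH i fun k => ?_)
  induction k with
  | zero => exact ⟨f, hf, by simp⟩
  | succ k ih =>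
    obtain ⟨g, hg, hfg⟩ := ih
    obtain ⟨g', hg', hgg'⟩ := hg.exists_eq_coord_mul hH i (hcon k g hg hfg)
    refine ⟨g', hg', ?_⟩
    filter_upwards [hfg, hgg'] with x h1 h2
    rw [h1, h2]; ring

end GermAlg

theorem IsAlgMap.tail {n : ℕ} :
    IsAlgMap H fun x : Fin (n + 1) → ℝ => (Fin.tail x : Fin n → ℝ) :=
  ⟨fun j => by simpa [Fin.tail] using GermAlg.coord j.succ, rfl⟩

theorem cons_zero_tail {n : ℕ} (x : Fin (n + 1) → ℝ) :
    (Fin.cons (α := fun _ => ℝ) 0 (Fin.tail x) : Fin (n + 1) → ℝ) = update x 0 0 := by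
  ext j
  refine Fin.cases ?_ (fun j => ?_) j <;> simp [Fin.tail]

theorem eventuallyEq_nhds_zero_of_fin_zero {f g : (Fin 0 → ℝ) → ℝ} (h : f 0 = g 0) :
    f =ᶠ[𝓝 0] g :=
  Eventually.of_forall fun x => by rw [Subsingleton.elim x 0, h]

namespace GermAlg

variable {n m : ℕ} {f g : (Fin n → ℝ) → ℝ}

/-- A nonzero germ in `n + 1` variables is the product of a power of the first variable and a germ
whose restriction to the hyperplane where that variable vanishes is a nonzero germ. -/
theorem exists_eq_zero_coord_pow_mul (hH : IsLeGalRolin H) {f : (Fin (n + 1) → ℝ) → ℝ}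
    (hf : GermAlg H (n + 1) f) (h0 : ¬ f =ᶠ[𝓝 0] fun _ => 0) :
    ∃ (k : ℕ) (g : (Fin (n + 1) → ℝ) → ℝ), GermAlg H (n + 1) g ∧
      (f =ᶠ[𝓝 0] fun x => x 0 ^ k * g x) ∧
      ¬ (fun y : Fin n → ℝ => g (Fin.cons (α := fun _ => ℝ) 0 y)) =ᶠ[𝓝 0] fun _ => 0 := by
  obtain ⟨k, g, hg, hfg, hg0⟩ := hf.exists_eq_coord_pow_mul hH h0 0
  refine ⟨k, g, hg, hfg, fun h => hg0 ?_⟩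
  simpa only [cons_zero_tail] using h.comp_algMap hH IsAlgMap.tail

/-- The germs of the algebra form a domain. -/
theorem eq_zero_or_eq_zero_of_mul (hH : IsLeGalRolin H) (hf : GermAlg H n f) (hg : GermAlg H n g)
    (h : (fun x => f x * g x) =ᶠ[𝓝 0] fun _ => 0) :
    (f =ᶠ[𝓝 0] fun _ => 0) ∨ g =ᶠ[𝓝 0] fun _ => 0 := by
  induction n with
  | zero =>
    rcases mul_eq_zero.1 h.eq_of_nhds with h | h
    · exact Or.inl (eventuallyEq_nhds_zero_of_fin_zero h)
    · exact Or.inr (eventuallyEq_nhds_zero_of_fin_zero h)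
  | succ n ih =>
    by_contra! hcon
    obtain ⟨k, f', hf', hff', hf0⟩ := hf.exists_eq_zero_coord_pow_mul hH hcon.1
    obtain ⟨l, g', hg', hgg', hg0⟩ := hg.exists_eq_zero_coord_pow_mul hH hcon.2
    have h' : (fun x => f' x * g' x) =ᶠ[𝓝 0] fun _ => 0 := by
      refine (hf'.prod hg').eventuallyEq_of_coord_ne_zero hH (const _ 0) 0 ?_
      filter_upwards [h, hff', hgg'] with x h1 h2 h3 hx
      rw [h2, h3] at h1
      have : x 0 ^ k * x 0 ^ l * (f' x * g' x) = 0 := by linear_combination h1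
      simpa [hx] using this
    rcases ih (hf'.comp_map IsAlgMap.cons_zero) (hg'.comp_map IsAlgMap.cons_zero)
      (h'.comp_algMap hH IsAlgMap.cons_zero) with h | h
    · exact hf0 h
    · exact hg0 h

theorem mul_ne_zero (hH : IsLeGalRolin H) (hf : GermAlg H n f) (hg : GermAlg H n g)
    (hf0 : ¬ f =ᶠ[𝓝 0] fun _ => 0) (hg0 : ¬ g =ᶠ[𝓝 0] fun _ => 0) :
    ¬ (fun x => f x * g x) =ᶠ[𝓝 0] fun _ => 0 := fun h =>
  (hf.eq_zero_or_eq_zero_of_mul hH hg h).elim hf0 hg0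

theorem finset_prod_ne_zero (hH : IsLeGalRolin H) {ι : Type*} (s : Finset ι)
    {f : ι → (Fin n → ℝ) → ℝ} (hf : ∀ i ∈ s, GermAlg H n (f i))
    (h0 : ∀ i ∈ s, ¬ f i =ᶠ[𝓝 0] fun _ => 0) :
    ¬ (fun x => ∏ i ∈ s, f i x) =ᶠ[𝓝 0] fun _ => 0 := by
  classical
  induction s using Finset.induction_on with
  | empty => exact fun h => by simpa using h.eq_of_nhds
  | insert a s ha ih =>
    simp only [Finset.prod_insert ha]
    exact mul_ne_zero hH (hf a (by simp)) (finset_prod s fun i hi => hf i (by simp [hi]))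
      (h0 a (by simp)) (ih (fun i hi => hf i (by simp [hi])) fun i hi => h0 i (by simp [hi]))

theorem pow_ne_zero (hH : IsLeGalRolin H) (hf : GermAlg H n f) (h0 : ¬ f =ᶠ[𝓝 0] fun _ => 0)
    (k : ℕ) : ¬ (fun x => f x ^ k) =ᶠ[𝓝 0] fun _ => 0 := by
  simpa using finset_prod_ne_zero hH (Finset.range k) (f := fun _ => f)
    (fun _ _ => hf) (fun _ _ => h0)

/-- Multiplication by a nonzero germ is injective. -/
theorem mul_left_cancel (hH : IsLeGalRolin H) {a : (Fin n → ℝ) → ℝ} (ha : GermAlg H n a)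
    (ha0 : ¬ a =ᶠ[𝓝 0] fun _ => 0) (hf : GermAlg H n f) (hg : GermAlg H n g)
    (h : (fun x => a x * f x) =ᶠ[𝓝 0] fun x => a x * g x) : f =ᶠ[𝓝 0] g := by
  have h1 : (fun x => a x * (f x - g x)) =ᶠ[𝓝 0] fun _ => 0 := by
    filter_upwards [h] with x hx
    rw [mul_sub, hx, sub_self]
  filter_upwards [(ha.eq_zero_or_eq_zero_of_mul hH (hf.sub hg) h1).resolve_left ha0] with x hx
  linarith

end GermAlg

theorem coord_ne_zero {n : ℕ} (i : Fin n) :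
    ¬ (fun x : Fin n → ℝ => x i) =ᶠ[𝓝 0] fun _ => 0 := fun h =>
  (((dense_coord_ne_zero i) 0 |> mem_closure_iff_frequently.1).and_eventually h).exists.elim
    fun _ hy => hy.1 hy.2

theorem ne_zero_of_apply_ne_zero {n : ℕ} {u : (Fin n → ℝ) → ℝ} (hu : u 0 ≠ 0) :
    ¬ u =ᶠ[𝓝 0] fun _ => 0 := fun h => hu h.eq_of_nhds

/-! ### Monomials times units -/

/-- The monomial `x ^ α`. -/
def monomial {n : ℕ} (α : Fin n → ℕ) (x : Fin n → ℝ) : ℝ := ∏ i, x i ^ α i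

theorem monomial_zero {n : ℕ} (x : Fin n → ℝ) : monomial 0 x = 1 := by simp [monomial]

theorem monomial_add {n : ℕ} (α β : Fin n → ℕ) (x : Fin n → ℝ) :
    monomial (α + β) x = monomial α x * monomial β x := by
  simp [monomial, pow_add, Finset.prod_mul_distrib]

theorem monomial_nsmul {n : ℕ} (k : ℕ) (α : Fin n → ℕ) (x : Fin n → ℝ) :
    monomial (k • α) x = monomial α x ^ k := by
  simp [monomial, mul_comm k, pow_mul, Finset.prod_pow]

theorem monomial_single {n : ℕ} (i : Fin n) (k : ℕ) (x : Fin n → ℝ) :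
    monomial (Pi.single i k) x = x i ^ k := by
  rw [monomial, Finset.prod_eq_single i] <;> simp +contextual

theorem monomial_snoc {n : ℕ} (α : Fin n → ℕ) (k : ℕ) (x : Fin (n + 1) → ℝ) :
    monomial (Fin.snoc (α := fun _ => ℕ) α k) x =
      monomial α (Fin.init x) * x (Fin.last n) ^ k := by
  simp [monomial, Fin.prod_univ_castSucc, Fin.init]

theorem germAlg_monomial {n : ℕ} (α : Fin n → ℕ) : GermAlg H n (monomial α) :=
  GermAlg.finset_prod _ fun i _ => (GermAlg.coord i).pow _

theorem monomial_ne_zero (hH : IsLeGalRolin H) {n : ℕ} (α : Fin n → ℕ) :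
    ¬ (monomial α) =ᶠ[𝓝 0] fun _ => 0 :=
  GermAlg.finset_prod_ne_zero hH _ (fun i _ => (GermAlg.coord i).pow _)
    fun i _ => (GermAlg.coord i).pow_ne_zero hH (coord_ne_zero i) _

/-- Induction on an exponent, one unit of one coordinate at a time. -/
theorem exponent_induction {n : ℕ} {P : (Fin n → ℕ) → Prop} (zero : P 0)
    (add_single : ∀ α i, P α → P (α + Pi.single i 1)) (α : Fin n → ℕ) : P α := by
  obtain ⟨N, hN⟩ : ∃ N, ∑ i, α i = N := ⟨_, rfl⟩
  induction N generalizing α with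
  | zero =>
    have : α = 0 := by
      funext i
      simpa using Finset.sum_eq_zero_iff.1 hN i (Finset.mem_univ i)
    rwa [this]
  | succ N ih =>
    obtain ⟨i, -, hi⟩ : ∃ i ∈ Finset.univ, α i ≠ 0 :=
      Finset.exists_ne_zero_of_sum_ne_zero (by omega)
    have hle : Pi.single i 1 ≤ α := by
      intro j
      by_cases h : j = i
      · subst h; simp; omega
      · simp [Pi.single_eq_of_ne h]
    rw [← tsub_add_cancel_of_le hle] at hN ⊢
    refine add_single _ i (ih _ ?_)
    simp only [Pi.add_apply, Finset.sum_add_distrib, Finset.sum_pi_single', Finset.mem_univ,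
      if_true] at hN
    omega

/-- A germ that is a monomial times a unit of the algebra. -/
def IsMonomialUnit (H : ℝ → ℝ) {n : ℕ} (f : (Fin n → ℝ) → ℝ) : Prop :=
  ∃ (α : Fin n → ℕ) (u : (Fin n → ℝ) → ℝ), GermAlg H n u ∧ u 0 ≠ 0 ∧
    f =ᶠ[𝓝 0] fun x => monomial α x * u x

namespace IsMonomialUnit

variable {n : ℕ} {f g : (Fin n → ℝ) → ℝ}

theorem congr (hf : IsMonomialUnit H f) (h : f =ᶠ[𝓝 0] g) : IsMonomialUnit H g := by
  obtain ⟨α, u, hu, hu0, hfu⟩ := hf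
  exact ⟨α, u, hu, hu0, h.symm.trans hfu⟩

theorem of_apply_ne_zero (hf : GermAlg H n f) (h : f 0 ≠ 0) : IsMonomialUnit H f :=
  ⟨0, f, hf, h, Eventually.of_forall fun x => by simp [monomial_zero]⟩

theorem mul (hf : IsMonomialUnit H f) (hg : IsMonomialUnit H g) :
    IsMonomialUnit H fun x => f x * g x := by
  obtain ⟨α, u, hu, hu0, hfu⟩ := hf
  obtain ⟨β, v, hv, hv0, hgv⟩ := hg
  refine ⟨α + β, fun x => u x * v x, hu.prod hv, _root_.mul_ne_zero hu0 hv0, ?_⟩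
  filter_upwards [hfu, hgv] with x h1 h2
  rw [h1, h2, monomial_add]; ring

theorem coord_pow (i : Fin n) (k : ℕ) : IsMonomialUnit H fun x : Fin n → ℝ => x i ^ k :=
  ⟨Pi.single i k, fun _ => 1, GermAlg.const n 1, one_ne_zero,
    Eventually.of_forall fun x => by simp [monomial_single]⟩

theorem comp_init {f : (Fin n → ℝ) → ℝ} (hH : IsLeGalRolin H) (hf : IsMonomialUnit H f) :
    IsMonomialUnit H fun x : Fin (n + 1) → ℝ => f (Fin.init x) := by
  obtain ⟨α, u, hu, hu0, hfu⟩ := hf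
  refine ⟨Fin.snoc (α := fun _ => ℕ) α 0, _, hu.comp_map IsAlgMap.init, hu0, ?_⟩
  filter_upwards [hfu.comp_algMap hH IsAlgMap.init] with x hx
  rw [hx, monomial_snoc]; ring

/-- A divisor of a monomial times a unit is again a monomial times a unit. -/
theorem of_mul (hH : IsLeGalRolin H) (hf : GermAlg H n f) (hg : GermAlg H n g)
    (h : IsMonomialUnit H fun x => f x * g x) : IsMonomialUnit H f := by
  obtain ⟨α, u, hu, hu0, hfu⟩ := h
  induction α using exponent_induction generalizing f g with
  | zero =>
    refine of_apply_ne_zero hf fun h => hu0 ?_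
    simpa [h, monomial_zero] using hfu.eq_of_nhds.symm
  | add_single α i ih =>
    have hfu' : (fun x => f x * g x) =ᶠ[𝓝 0] fun x => x i * (monomial α x * u x) := by
      filter_upwards [hfu] with x hx
      rw [hx, monomial_add, monomial_single]; ring
    have h0 : (fun x => f (update x i 0) * g (update x i 0)) =ᶠ[𝓝 0] fun _ => 0 := by
      filter_upwards [hfu'.comp_algMap hH (IsAlgMap.update_zero i)] with x hx
      simpa using hx
    have hmu := (germAlg_monomial α).prod hu
    rcases (hf.comp_map (IsAlgMap.update_zero i)).eq_zero_or_eq_zero_of_mul hH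
      (hg.comp_map (IsAlgMap.update_zero i)) h0 with h | h
    · obtain ⟨f', hf', hff'⟩ := hf.exists_eq_coord_mul hH i h
      have := ih hf' hg ((GermAlg.coord i).mul_left_cancel hH (coord_ne_zero i)
        (hf'.prod hg) hmu <| by
        filter_upwards [hfu', hff'] with x h1 h2
        rw [← h1, h2]; ring)
      refine ((coord_pow i 1).mul this).congr ?_
      filter_upwards [hff'] with x hx
      rw [hx, pow_one]
    · obtain ⟨g', hg', hgg'⟩ := hg.exists_eq_coord_mul hH i h
      exact ih hf hg' ((GermAlg.coord i).mul_left_cancel hH (coord_ne_zero i)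
        (hf.prod hg') hmu <| by
        filter_upwards [hfu', hgg'] with x h1 h2
        rw [← h1, h2]; ring)

end IsMonomialUnit

/-- A germ bounded by a monomial is divisible by that monomial in the algebra. -/
theorem GermAlg.exists_eq_monomial_mul (hH : IsLeGalRolin H) {n : ℕ} {f : (Fin n → ℝ) → ℝ}
    (hf : GermAlg H n f) (α : Fin n → ℕ) (C : ℝ)
    (h : ∀ᶠ x in 𝓝 (0 : Fin n → ℝ), |f x| ≤ C * |monomial α x|) :
    ∃ g, GermAlg H n g ∧ f =ᶠ[𝓝 0] fun x => monomial α x * g x := by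
  induction α using exponent_induction generalizing f with
  | zero => exact ⟨f, hf, by simp [monomial_zero]⟩
  | add_single α i ih =>
    obtain ⟨f', hf', hff'⟩ := hf.exists_eq_coord_mul hH i (by
      filter_upwards [((IsAlgMap.update_zero (H := H) i).tendsto hH).eventually h] with x hx
      simpa [monomial_add, monomial_single] using hx)
    have hne : ∀ᶠ x in 𝓝 (0 : Fin n → ℝ), x i ≠ 0 → |f' x| ≤ C * |monomial α x| := by
      filter_upwards [h, hff'] with x h1 h2 hx
      rw [h2, monomial_add, monomial_single, abs_mul, abs_mul, pow_one] at h1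
      have : 0 < |x i| := abs_pos.2 hx
      refine le_of_mul_le_mul_left ?_ this
      linarith
    obtain ⟨g, hg, hfg⟩ := ih hf' <| by
      filter_upwards [hne.eventually_nhds, hf'.eventually_continuousAt hH,
        (germAlg_monomial α).eventually_continuousAt hH] with x hx h1 h2
      by_contra! hlt
      have h3 := (h2.abs.const_mul C).eventually_lt h1.abs hlt
      obtain ⟨y, hy, hy1, hy2⟩ := (((dense_coord_ne_zero i) x |>
        mem_closure_iff_frequently.1).and_eventually (hx.and h3)).exists
      exact absurd (hy1 hy) (not_le.2 hy2)
    refine ⟨g, hg, ?_⟩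
    filter_upwards [hff', hfg] with x h1 h2
    rw [h1, h2, monomial_add, monomial_single]; ring

/-! ### Normalizable germs -/

/-- The blow-up chart `xᵢ = xⱼ (c + xᵢ)`. -/
def blowUpMap {n : ℕ} (i j : Fin n) (c : ℝ) (x : Fin n → ℝ) : Fin n → ℝ :=
  update x i (x j * (c + x i))

/-- The translation `xᵢ = xᵢ + h(x)`, meant for `h` independent of `xᵢ`. -/
def translateMap {n : ℕ} (i : Fin n) (h : (Fin n → ℝ) → ℝ) (x : Fin n → ℝ) : Fin n → ℝ :=
  update x i (x i + h x)

/-- The ramification `xᵢ = ε xᵢ ^ d`. -/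
def ramifyMap {n : ℕ} (i : Fin n) (d : ℕ) (ε : ℝ) (x : Fin n → ℝ) : Fin n → ℝ :=
  update x i (ε * x i ^ d)

theorem isAlgMap_blowUpMap {n : ℕ} (i j : Fin n) (c : ℝ) : IsAlgMap H (blowUpMap i j c) :=
  IsAlgMap.id.update i ((GermAlg.coord j).prod ((GermAlg.const n c).sum (GermAlg.coord i)))
    (by simp)

theorem isAlgMap_translateMap {n : ℕ} (i : Fin n) {h : (Fin n → ℝ) → ℝ} (hh : GermAlg H n h)
    (h0 : h 0 = 0) : IsAlgMap H (translateMap i h) :=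
  IsAlgMap.id.update i ((GermAlg.coord i).sum hh) (by simp [h0])

theorem isAlgMap_ramifyMap {n : ℕ} (i : Fin n) {d : ℕ} (hd : 0 < d) (ε : ℝ) :
    IsAlgMap H (ramifyMap i d ε) :=
  IsAlgMap.id.update i ((GermAlg.const n ε).prod ((GermAlg.coord i).pow d)) (by simp [hd.ne'])

/-- The germs that become a monomial times a unit at every leaf of some well-founded tree whose
nodes are translations of one variable by a germ in the others, families of blow-up charts of a
codimension two subspace, one for each slope in the projective line, and pairs of ramifications of
opposite signs. The values `c : ℝ` and the chart with the two variables exchanged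
exhaust the slopes. -/
inductive Normalizable (H : ℝ → ℝ) {n : ℕ} : ((Fin n → ℝ) → ℝ) → Prop
  | of_isMonomialUnit {f : (Fin n → ℝ) → ℝ} : IsMonomialUnit H f → Normalizable H f
  | translate {f : (Fin n → ℝ) → ℝ} (i : Fin n) (h : (Fin n → ℝ) → ℝ) :
      GermAlg H n h → (∀ x s, h (update x i s) = h x) → h 0 = 0 →
      Normalizable H (fun x => f (translateMap i h x)) → Normalizable H f
  | blowUp {f : (Fin n → ℝ) → ℝ} (i j : Fin n) : i ≠ j →
      (∀ c, Normalizable H (fun x => f (blowUpMap i j c x))) →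
      Normalizable H (fun x => f (blowUpMap j i 0 x)) → Normalizable H f
  | ramify {f : (Fin n → ℝ) → ℝ} (i : Fin n) (d : ℕ) : 0 < d →
      (∀ ε : ℝ, ε = 1 ∨ ε = -1 → Normalizable H (fun x => f (ramifyMap i d ε x))) →
      Normalizable H f

theorem Normalizable.congr (hH : IsLeGalRolin H) {n : ℕ} {f g : (Fin n → ℝ) → ℝ}
    (hf : Normalizable H f) (hfg : f =ᶠ[𝓝 0] g) : Normalizable H g := by
  induction hf generalizing g with
  | of_isMonomialUnit h => exact .of_isMonomialUnit (h.congr hfg)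
  | translate i h hh hi h0 _ ih =>
    exact .translate i h hh hi h0 (ih (hfg.comp_algMap hH (isAlgMap_translateMap i hh h0)))
  | blowUp i j hij _ _ ih₁ ih₂ =>
    exact .blowUp i j hij (fun c => ih₁ c (hfg.comp_algMap hH (isAlgMap_blowUpMap i j c)))
      (ih₂ (hfg.comp_algMap hH (isAlgMap_blowUpMap j i 0)))
  | ramify i d hd _ ih =>
    exact .ramify i d hd fun ε hε => ih ε hε (hfg.comp_algMap hH (isAlgMap_ramifyMap i hd ε))

/-- The map acting by `ρ` on all variables but the last, which it leaves alone. -/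
def liftMap {m : ℕ} (ρ : (Fin m → ℝ) → (Fin m → ℝ)) (x : Fin (m + 1) → ℝ) : Fin (m + 1) → ℝ :=
  Fin.snoc (α := fun _ => ℝ) (ρ (Fin.init x)) (x (Fin.last m))

theorem isAlgMap_liftMap {m : ℕ} {ρ : (Fin m → ℝ) → (Fin m → ℝ)} (hρ : IsAlgMap H ρ) :
    IsAlgMap H (liftMap ρ) :=
  (hρ.comp IsAlgMap.init).snoc (GermAlg.coord _) rfl

@[simp] theorem init_liftMap {m : ℕ} (ρ : (Fin m → ℝ) → (Fin m → ℝ)) (x : Fin (m + 1) → ℝ) :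
    (Fin.init (liftMap ρ x) : Fin m → ℝ) = ρ (Fin.init x) := by
  simp [liftMap]

@[simp] theorem liftMap_last {m : ℕ} (ρ : (Fin m → ℝ) → (Fin m → ℝ)) (x : Fin (m + 1) → ℝ) :
    liftMap ρ x (Fin.last m) = x (Fin.last m) := by
  simp [liftMap]

theorem liftMap_update {m : ℕ} (i : Fin m) (h : (Fin m → ℝ) → ℝ) (x : Fin (m + 1) → ℝ) :
    liftMap (fun x => update x i (h x)) x = update x i.castSucc (h (Fin.init x)) := by
  rw [liftMap, Fin.snoc_update, Fin.snoc_init_self]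

/-- A normalization in the first `m` variables can be carried out on a germ in `m + 1` variables. -/
theorem Normalizable.extend {m : ℕ} {G : (Fin m → ℝ) → ℝ} (hG : Normalizable H G) :
    ∀ {F : (Fin (m + 1) → ℝ) → ℝ}, (∀ ρ : (Fin m → ℝ) → (Fin m → ℝ), IsAlgMap H ρ →
      IsMonomialUnit H (fun x => G (ρ x)) → Normalizable H fun x => F (liftMap ρ x)) →
      Normalizable H F := by
  have hcomp : ∀ (F : (Fin (m + 1) → ℝ) → ℝ) (ν ρ : (Fin m → ℝ) → (Fin m → ℝ)),
      (fun x => F (liftMap ν (liftMap ρ x))) = fun x => F (liftMap (fun x => ν (ρ x)) x) := by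
    intro F ν ρ
    funext x
    simp [liftMap]
  induction hG with
  | of_isMonomialUnit h =>
    intro F hF
    simpa [liftMap, Fin.snoc_init_self] using hF (fun x => x) IsAlgMap.id h
  | @translate G i h hh hi h0 _ ih =>
    intro F hF
    refine .translate i.castSucc (fun x => h (Fin.init x)) (hh.comp_map IsAlgMap.init)
      (fun x s => by rw [Fin.init_update_castSucc, hi]) h0 ?_
    have : translateMap i.castSucc (fun x => h (Fin.init x)) = liftMap (translateMap i h) :=
      funext fun x => (liftMap_update i (fun x => x i + h x) x).symm
    rw [this]
    refine ih fun ρ hρ hGρ => ?_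
    rw [hcomp]
    exact hF _ ((isAlgMap_translateMap i hh h0).comp hρ) hGρ
  | @blowUp G i j hij _ _ ih₁ ih₂ =>
    intro F hF
    have hl : ∀ (i j : Fin m) (c : ℝ),
        blowUpMap i.castSucc j.castSucc c = liftMap (blowUpMap i j c) := fun i j c =>
      funext fun x => (liftMap_update i (fun x => x j * (c + x i)) x).symm
    refine .blowUp i.castSucc j.castSucc (by simpa using hij) (fun c => ?_) ?_
    · rw [hl]
      refine ih₁ c fun ρ hρ hGρ => ?_
      rw [hcomp]
      exact hF _ ((isAlgMap_blowUpMap i j c).comp hρ) hGρ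
    · rw [hl]
      refine ih₂ fun ρ hρ hGρ => ?_
      rw [hcomp]
      exact hF _ ((isAlgMap_blowUpMap j i 0).comp hρ) hGρ
  | @ramify G i d hd _ ih =>
    intro F hF
    refine .ramify i.castSucc d hd fun ε hε => ?_
    have : ramifyMap i.castSucc d ε = liftMap (ramifyMap i d ε) :=
      funext fun x => (liftMap_update i (fun x => ε * x i ^ d) x).symm
    rw [this]
    refine ih ε hε fun ρ hρ hGρ => ?_
    rw [hcomp]
    exact hF _ ((isAlgMap_ramifyMap i hd ε).comp hρ) hGρ

/-- All variables may be ramified at once. -/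
theorem Normalizable.ramify_all {m N : ℕ} (hN : 0 < N) {F : (Fin (m + 1) → ℝ) → ℝ}
    (h : ∀ ε : Fin m → ℝ, (∀ l, ε l = 1 ∨ ε l = -1) →
      Normalizable H fun x => F (liftMap (fun y l => ε l * y l ^ N) x)) :
    Normalizable H F := by
  classical
  let R : Finset (Fin m) → (Fin m → ℝ) → (Fin m → ℝ) → (Fin m → ℝ) := fun s ε y l =>
    if l ∈ s then ε l * y l ^ N else y l
  have key : ∀ s : Finset (Fin m), (∀ ε : Fin m → ℝ, (∀ l, ε l = 1 ∨ ε l = -1) →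
      Normalizable H fun x => F (liftMap (R s ε) x)) → Normalizable H F := by
    intro s
    induction s using Finset.induction_on with
    | empty =>
      intro h
      simpa [R, liftMap, Fin.snoc_init_self] using h (fun _ => 1) (fun _ => Or.inl rfl)
    | insert a s ha ih =>
      refine fun h => ih fun ε hε => .ramify a.castSucc N hN fun δ hδ => ?_
      have h1 := h (update ε a δ) (fun l => by
        by_cases hl : l = a
        · subst hl; simpa using hδ
        · simpa [update_of_ne hl] using hε l)
      convert h1 using 2 with x
      congr 1
      rw [liftMap, liftMap, ramifyMap, Fin.init_update_castSucc,
        update_of_ne (Fin.castSucc_lt_last a).ne']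
      congr 1
      ext l
      by_cases hl : l = a
      · subst hl; simp [R, ha, Fin.init]
      · simp [R, hl]
  exact key Finset.univ (by simpa [R] using h)

/-- All variables but the last may be translated at once by positive powers of the last one. -/
theorem Normalizable.translate_pow {m : ℕ} (N : Fin m → ℕ) (hN : ∀ k, 0 < N k)
    {F : (Fin (m + 1) → ℝ) → ℝ}
    (h : Normalizable H fun x => F (Fin.snoc (α := fun _ => ℝ)
      (fun k => x k.castSucc + x (Fin.last m) ^ N k) (x (Fin.last m)))) :
    Normalizable H F := by
  classical
  let T : Finset (Fin m) → (Fin (m + 1) → ℝ) → (Fin (m + 1) → ℝ) := fun s x =>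
    Fin.snoc (α := fun _ => ℝ)
      (fun k => if k ∈ s then x k.castSucc + x (Fin.last m) ^ N k else x k.castSucc)
      (x (Fin.last m))
  have key : ∀ s : Finset (Fin m), Normalizable H (fun x => F (T s x)) → Normalizable H F := by
    intro s
    induction s using Finset.induction_on with
    | empty =>
      intro h
      have : ∀ x, T ∅ x = x := fun x => by
        simp only [T, Finset.notMem_empty, if_false]
        exact Fin.snoc_init_self x
      simpa only [this] using h
    | insert a s ha ih =>
      refine fun h => ih (.translate a.castSucc (fun x => x (Fin.last m) ^ N a)
        ((GermAlg.coord _).pow _) (fun x t => by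
          rw [update_of_ne (Fin.castSucc_lt_last a).ne']) (by simp [(hN a).ne']) ?_)
      convert h using 2 with x
      congr 1
      simp only [T, translateMap]
      rw [update_of_ne (Fin.castSucc_lt_last a).ne']
      congr 1
      ext k
      by_cases hk : k = a
      · subst hk; simp [ha]
      · simp [hk]
  exact key Finset.univ (by simpa [T] using h)

/-! ### Taylor expansion and regularity in one variable -/

theorem update_last_eq_snoc {m : ℕ} (x : Fin (m + 1) → ℝ) (t : ℝ) :
    update x (Fin.last m) t = Fin.snoc (α := fun _ => ℝ) (Fin.init x) t := by
  conv_lhs => rw [← Fin.snoc_init_self x]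
  exact Fin.update_snoc_last ..

namespace GermAlg

/-- Differentiation with respect to `xᵢ` commutes with a translation of `xᵢ` by a germ independent
of `xᵢ`. -/
theorem iterate_partialDeriv_comp_translateMap (hH : IsLeGalRolin H) {n : ℕ}
    {f : (Fin n → ℝ) → ℝ} (hf : GermAlg H n f) (i : Fin n) {h : (Fin n → ℝ) → ℝ}
    (hh : GermAlg H n h) (hi : ∀ x s, h (update x i s) = h x) (h0 : h 0 = 0) (k : ℕ) :
    (HSets.partialDeriv i)^[k] (fun x => f (translateMap i h x)) =ᶠ[𝓝 0]
      fun x => (HSets.partialDeriv i)^[k] f (translateMap i h x) := by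
  have hT := isAlgMap_translateMap i hh h0
  induction k with
  | zero => exact EventuallyEq.rfl
  | succ k ih =>
    simp only [iterate_succ_apply']
    refine (partialDeriv_congr i ih).trans ?_
    have hk := hf.iterate_partialDeriv hH i k
    filter_upwards [((hk.comp_map hT).weaklySmooth hH).eventually_differentiableAt,
      (hT.tendsto hH).eventually (hk.weaklySmooth hH).eventually_differentiableAt] with x h1 h2
    have h3 := hasDerivAt_comp_update i h1
    have h4 := hasDerivAt_comp_update i h2
    simp only [translateMap, update_self, update_idem, hi] at h3 h4
    exact h3.unique (h4.comp_add_const (x i) (h x))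

theorem iterate_partialDeriv_hadamardQuotient (hH : IsLeGalRolin H) {m : ℕ}
    {f : (Fin (m + 1) → ℝ) → ℝ} (hf : GermAlg H (m + 1) f) (k : ℕ) :
    (HSets.partialDeriv (Fin.last m))^[k + 1] f =ᶠ[𝓝 0] fun x =>
      x (Fin.last m) *
        (HSets.partialDeriv (Fin.last m))^[k + 1] (HSets.hadamardQuotient (Fin.last m) f) x +
      (k + 1) *
        (HSets.partialDeriv (Fin.last m))^[k] (HSets.hadamardQuotient (Fin.last m) f) x := by
  set g := HSets.hadamardQuotient (Fin.last m) f with hg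
  have hgA : GermAlg H (m + 1) g := hf.hadamardQuotient hH _
  have hdt : ∀ x : Fin (m + 1) → ℝ,
      HSets.partialDeriv (Fin.last m) (fun x => x (Fin.last m)) x = 1 := fun x => by
    simpa using partialDeriv_coord_pow (Fin.last m) (Fin.last m) 0 x
  induction k with
  | zero =>
    have h1 : f =ᶠ[𝓝 0] fun x => f (update x (Fin.last m) 0) + x (Fin.last m) * g x :=
      (hf.weaklySmooth hH).eq_add_mul_hadamardQuotient (Fin.last m)
    refine (partialDeriv_congr (Fin.last m) h1).trans ?_
    have h2 := hf.comp_map (IsAlgMap.update_zero (Fin.last m))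
    filter_upwards [(h2.weaklySmooth hH).eventually_differentiableAt,
      (hgA.weaklySmooth hH).eventually_differentiableAt] with x h3 h4
    have h5 := hasDerivAt_comp_update (Fin.last m) h3
    simp only [update_idem] at h5
    have h6 := h5.unique (hasDerivAt_const _ _)
    have h7 : HSets.partialDeriv (Fin.last m) (fun x => f (update x (Fin.last m) 0) +
        x (Fin.last m) * g x) x = HSets.partialDeriv (Fin.last m)
          (fun x => f (update x (Fin.last m) 0)) x + HSets.partialDeriv (Fin.last m)
          (fun x => x (Fin.last m) * g x) x := by
      unfold HSets.partialDeriv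
      rw [fderiv_fun_add h3 (by fun_prop)]
      rfl
    rw [h7, h6, partialDeriv_mul _ (by fun_prop) h4, hdt]
    simp
  | succ k ih =>
    rw [iterate_succ_apply']
    refine (partialDeriv_congr (Fin.last m) ih).trans ?_
    filter_upwards [((hgA.iterate_partialDeriv hH (Fin.last m) (k + 1)).weaklySmooth
        hH).eventually_differentiableAt, ((hgA.iterate_partialDeriv hH (Fin.last m) k).weaklySmooth
        hH).eventually_differentiableAt] with x h1 h2
    have h7 : HSets.partialDeriv (Fin.last m) (fun x => x (Fin.last m) *
          (HSets.partialDeriv (Fin.last m))^[k + 1] g x +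
          (k + 1) * (HSets.partialDeriv (Fin.last m))^[k] g x) x =
        HSets.partialDeriv (Fin.last m) (fun x => x (Fin.last m) *
          (HSets.partialDeriv (Fin.last m))^[k + 1] g x) x +
        (k + 1) * HSets.partialDeriv (Fin.last m) ((HSets.partialDeriv (Fin.last m))^[k] g) x := by
      unfold HSets.partialDeriv at h1 h2 ⊢
      rw [fderiv_fun_add (by fun_prop) (by fun_prop), fderiv_const_mul h2]
      rfl
    rw [h7, partialDeriv_mul _ (by fun_prop) h1, hdt, ← iterate_succ_apply' (HSets.partialDeriv _),
      ← iterate_succ_apply' (HSets.partialDeriv _)]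
    push_cast
    ring

/-- Taylor expansion with respect to the last variable, with remainder in the algebra. -/
theorem exists_taylor (hH : IsLeGalRolin H) {m : ℕ} {f : (Fin (m + 1) → ℝ) → ℝ}
    (hf : GermAlg H (m + 1) f) (d : ℕ) :
    ∃ u, GermAlg H (m + 1) u ∧
      u 0 = (HSets.partialDeriv (Fin.last m))^[d] f 0 / d.factorial ∧
      f =ᶠ[𝓝 0] fun x => (∑ j ∈ Finset.range d, (HSets.partialDeriv (Fin.last m))^[j] f
        (update x (Fin.last m) 0) / j.factorial * x (Fin.last m) ^ j) +
        x (Fin.last m) ^ d * u x := by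
  induction d generalizing f with
  | zero => exact ⟨f, hf, by simp, by simp⟩
  | succ d ih =>
    obtain ⟨u, hu, hu0, hfu⟩ := ih (hf.hadamardQuotient hH (Fin.last m))
    have hfac : ∀ j : ℕ, ((j + 1).factorial : ℝ) = (j + 1) * j.factorial := fun j => by
      push_cast [Nat.factorial_succ]; ring
    refine ⟨u, hu, ?_, ?_⟩
    · have := (hf.iterate_partialDeriv_hadamardQuotient hH d).eq_of_nhds
      have hd : ((d : ℝ) + 1) ≠ 0 := by positivity
      have hd' : (d.factorial : ℝ) ≠ 0 := by positivity
      rw [this, hu0, hfac]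
      simp only [Pi.zero_apply, zero_mul, zero_add]
      field_simp
    · have h1 : ∀ᶠ x in 𝓝 (0 : Fin (m + 1) → ℝ), ∀ j ∈ Finset.range d,
          (HSets.partialDeriv (Fin.last m))^[j + 1] f (update x (Fin.last m) 0) =
          (j + 1) * (HSets.partialDeriv (Fin.last m))^[j] (HSets.hadamardQuotient (Fin.last m) f)
            (update x (Fin.last m) 0) := by
        refine (Finset.eventually_all _).2 fun j _ => ?_
        filter_upwards [(hf.iterate_partialDeriv_hadamardQuotient hH j).comp_algMap hH
          (IsAlgMap.update_zero (Fin.last m))] with x hx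
        simpa using hx
      filter_upwards [(hf.weaklySmooth hH).eq_add_mul_hadamardQuotient (Fin.last m), hfu, h1]
        with x h2 h3 h4
      rw [Finset.sum_range_succ', h2, h3, mul_add, Finset.mul_sum]
      have : ∑ j ∈ Finset.range d, x (Fin.last m) *
          ((HSets.partialDeriv (Fin.last m))^[j] (HSets.hadamardQuotient (Fin.last m) f)
            (update x (Fin.last m) 0) / j.factorial * x (Fin.last m) ^ j) =
          ∑ j ∈ Finset.range d, (HSets.partialDeriv (Fin.last m))^[j + 1] f
            (update x (Fin.last m) 0) / (j + 1).factorial * x (Fin.last m) ^ (j + 1) := by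
        refine Finset.sum_congr rfl fun j hj => ?_
        have hd : ((j : ℝ) + 1) ≠ 0 := by positivity
        have hd' : (j.factorial : ℝ) ≠ 0 := by positivity
        rw [h4 j hj, hfac]
        field_simp
        ring
      rw [this]
      simp
      ring

/-- A nonzero germ in one variable is the product of a power of the variable and a unit. -/
theorem exists_eq_pow_mul_unit (hH : IsLeGalRolin H) {f : (Fin 1 → ℝ) → ℝ} (hf : GermAlg H 1 f)
    (h0 : ¬ f =ᶠ[𝓝 0] fun _ => 0) :
    ∃ (l : ℕ) (v : (Fin 1 → ℝ) → ℝ), GermAlg H 1 v ∧ v 0 ≠ 0 ∧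
      f =ᶠ[𝓝 0] fun t => t 0 ^ l * v t := by
  obtain ⟨l, v, hv, hfv, hv0⟩ := hf.exists_eq_zero_coord_pow_mul hH h0
  refine ⟨l, v, hv, fun h => hv0 (eventuallyEq_nhds_zero_of_fin_zero ?_), hfv⟩
  have h1 : (Fin.cons (α := fun _ => ℝ) 0 (0 : Fin 0 → ℝ) : Fin 1 → ℝ) = 0 := by
    ext j
    exact Fin.cases rfl (fun j => j.elim0) j
  simpa only [h1] using h

theorem isAlgMap_powCurve {n : ℕ} {N : Fin n → ℕ} (hN : ∀ k, 0 < N k) :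
    IsAlgMap H fun t : Fin 1 → ℝ =>
      (Fin.snoc (α := fun _ => ℝ) (fun k => t 0 ^ N k) (t 0) : Fin (n + 1) → ℝ) :=
  IsAlgMap.snoc ⟨fun k => (coord 0).pow _, funext fun k => by simp [(hN k).ne']⟩ (coord 0) rfl

/-- A nonzero germ does not vanish identically on a suitable curve `(t ^ N₁, …, t ^ Nₙ, t)`. -/
theorem exists_powCurve (hH : IsLeGalRolin H) {n : ℕ} {f : (Fin (n + 1) → ℝ) → ℝ}
    (hf : GermAlg H (n + 1) f) (h0 : ¬ f =ᶠ[𝓝 0] fun _ => 0) :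
    ∃ N : Fin n → ℕ, (∀ k, 0 < N k) ∧
      ¬ (fun t : Fin 1 → ℝ => f (Fin.snoc (α := fun _ => ℝ) (fun k => t 0 ^ N k) (t 0)))
        =ᶠ[𝓝 0] fun _ => 0 := by
  induction n with
  | zero =>
    refine ⟨fun _ => 1, fun _ => one_pos, ?_⟩
    have : ∀ t : Fin 1 → ℝ, (Fin.snoc (α := fun _ => ℝ) (fun k : Fin 0 => t 0 ^ 1) (t 0) :
        Fin 1 → ℝ) = t := fun t => by
      ext j
      rw [Subsingleton.elim (α := Fin 1) j (Fin.last 0), Fin.snoc_last]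
      rfl
    simpa only [this] using h0
  | succ n ih =>
    obtain ⟨k, g, hg, hfg, hg0⟩ := hf.exists_eq_zero_coord_pow_mul hH h0
    obtain ⟨N, hN, hNg⟩ := ih (hg.comp_map IsAlgMap.cons_zero) hg0
    obtain ⟨l, v, hv, hv0, hgv⟩ := ((hg.comp_map IsAlgMap.cons_zero).comp_map
      (isAlgMap_powCurve hN)).exists_eq_pow_mul_unit hH hNg
    -- The first component `t ^ (l + 1)` is a perturbation of order higher than that of the
    -- restriction of `g` to the curve found so far.
    let N' : Fin (n + 1) → ℕ := Fin.cons (α := fun _ => ℕ) (l + 1) N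
    have hN' : ∀ k, 0 < N' k := fun j => Fin.cases (by simp [N']) (fun j => by simp [N', hN]) j
    refine ⟨N', hN', fun h => hv0 ?_⟩
    have hcurve : ∀ t : Fin 1 → ℝ,
        (Fin.snoc (α := fun _ => ℝ) (fun k => t 0 ^ N' k) (t 0) : Fin (n + 2) → ℝ) =
        Fin.cons (α := fun _ => ℝ) (t 0 ^ (l + 1))
          (Fin.snoc (α := fun _ => ℝ) (fun k => t 0 ^ N k) (t 0)) := fun t => by
      rw [Fin.cons_snoc_eq_snoc_cons]
      congr 1
      ext j
      refine Fin.cases ?_ (fun j => ?_) j <;> simp [N']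
    have hq := (hg.hadamardQuotient hH 0).comp_map (isAlgMap_powCurve hN')
    have hgq : (fun x => g x) =ᶠ[𝓝 0] fun x => g (update x 0 0) +
      x 0 * HSets.hadamardQuotient 0 g x := (hg.weaklySmooth hH).eq_add_mul_hadamardQuotient 0
    have hzero : ∀ p : ℕ, ¬ (fun t : Fin 1 → ℝ => t 0 ^ p) =ᶠ[𝓝 0] fun _ => 0 := fun p =>
      (coord 0).pow_ne_zero hH (coord_ne_zero 0) p
    have key := ((coord (H := H) (0 : Fin 1)).pow ((l + 1) * k + l)).mul_left_cancel hH
      (hzero _) (hv.sum ((coord 0).prod hq)) (const 1 0) (by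
      filter_upwards [h, hfg.comp_algMap hH (isAlgMap_powCurve hN'),
        hgq.comp_algMap hH (isAlgMap_powCurve hN'), hgv] with t h1 h2 h3 h4
      have hup : update (Fin.snoc (α := fun _ => ℝ) (fun k => t 0 ^ N' k) (t 0) :
          Fin (n + 2) → ℝ) 0 0 = Fin.cons (α := fun _ => ℝ) 0
          (Fin.snoc (α := fun _ => ℝ) (fun k => t 0 ^ N k) (t 0)) := by
        rw [hcurve, Fin.update_cons_zero]
      have hc0 : (Fin.snoc (α := fun _ => ℝ) (fun k => t 0 ^ N' k) (t 0) :
          Fin (n + 2) → ℝ) 0 = t 0 ^ (l + 1) := by rw [hcurve, Fin.cons_zero]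
      rw [h2, h3, hup, h4, hc0] at h1
      rw [mul_zero, ← h1]
      ring)
    simpa using key.eq_of_nhds

end GermAlg

/-- After a translation of the first variables by powers of the last one, a nonzero germ has a
nonzero derivative of some order with respect to the last variable. -/
theorem GermAlg.exists_regular (hH : IsLeGalRolin H) {m : ℕ} {f : (Fin (m + 1) → ℝ) → ℝ}
    (hf : GermAlg H (m + 1) f) (h0 : ¬ f =ᶠ[𝓝 0] fun _ => 0) :
    ∃ N : Fin m → ℕ, (∀ k, 0 < N k) ∧ ∃ d, (HSets.partialDeriv (Fin.last m))^[d]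
      (fun x => f (Fin.snoc (α := fun _ => ℝ)
        (fun k => x k.castSucc + x (Fin.last m) ^ N k) (x (Fin.last m)))) 0 ≠ 0 := by
  obtain ⟨N, hN, hNf⟩ := hf.exists_powCurve hH h0
  refine ⟨N, hN, ?_⟩
  obtain ⟨l, v, hv, hv0, hfv⟩ :=
    (hf.comp_map (isAlgMap_powCurve hN)).exists_eq_pow_mul_unit hH hNf
  have hT : IsAlgMap H fun x : Fin (m + 1) → ℝ => (Fin.snoc (α := fun _ => ℝ)
        (fun k => x k.castSucc + x (Fin.last m) ^ N k) (x (Fin.last m)) : Fin (m + 1) → ℝ) :=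
    IsAlgMap.snoc ⟨fun k => (coord _).sum ((coord _).pow _),
      funext fun k => by simp [(hN k).ne']⟩ (coord _) rfl
  by_contra! hcon
  obtain ⟨u, hu, -, hFu⟩ := (hf.comp_map hT).exists_taylor hH (l + 1)
  have hslice : IsAlgMap H fun t : Fin 1 → ℝ =>
      update (0 : Fin (m + 1) → ℝ) (Fin.last m) (t 0) :=
    IsAlgMap.update (ρ := fun _ => 0) ⟨fun j => const _ _, rfl⟩ _ (coord 0) rfl
  refine hv0 ?_
  have key := ((coord (H := H) (0 : Fin 1)).pow l).mul_left_cancel hH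
    ((coord 0).pow_ne_zero hH (coord_ne_zero 0) l) hv ((coord 0).prod (hu.comp_map hslice)) (by
      filter_upwards [hfv, hFu.comp_algMap hH hslice] with t h1 h2
      rw [← h1]
      have hz : update (0 : Fin (m + 1) → ℝ) (Fin.last m) 0 = 0 := by simp
      simp only [update_idem, update_self, hz, hcon, zero_div, zero_mul,
        Finset.sum_const_zero, zero_add, update_of_ne (Fin.castSucc_lt_last _).ne,
        Pi.zero_apply] at h2
      rw [h2]
      ring)
  simpa using key.eq_of_nhds

/-! ### Decreasing the order of regularity -/

theorem GermAlg.exists_implicit (hH : IsLeGalRolin H) {m : ℕ} {f : (Fin (m + 1) → ℝ) → ℝ}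
    (hf : GermAlg H (m + 1) f) (h0 : f 0 = 0)
    (h1 : HSets.partialDeriv (Fin.last m) f 0 ≠ 0) :
    ∃ φ, GermAlg H m φ ∧ φ 0 = 0 ∧
      ∀ᶠ x in 𝓝 (0 : Fin m → ℝ), f (Fin.snoc (α := fun _ => ℝ) x (φ x)) = 0 := by
  let s : (Fin m → ℝ) × ℝ → (Fin (m + 1) → ℝ) := fun q => Fin.snoc (α := fun _ => ℝ) q.1 q.2
  have hs : ContDiff ℝ ∞ s := by
    refine contDiff_pi.2 fun j => ?_
    refine Fin.lastCases ?_ (fun j => ?_) j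
    · simpa [s] using contDiff_snd
    · simp only [s, Fin.snoc_castSucc]
      fun_prop
  have hs0 : s (0, 0) = 0 := by
    ext j
    refine Fin.lastCases ?_ (fun j => ?_) j <;> simp [s]
  have hF : ContDiffAt ℝ ∞ (fun q => f (s q)) ((0 : Fin m → ℝ), (0 : ℝ)) := by
    have hf' : ContDiffAt ℝ ∞ f (s (0, 0)) := by rw [hs0]; exact hf.weaklySmooth hH
    exact hf'.comp _ hs.contDiffAt
  have hd : HasDerivAt (fun t => f (s (0, t)))
      ((fderiv ℝ (fun q => f (s q)) (0, 0) ∘L .inr ℝ (Fin m → ℝ) ℝ) 1) 0 := by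
    have h2 := (hF.differentiableAt (by simp)).hasFDerivAt
    have h3 : HasDerivAt (fun t : ℝ => ((0 : Fin m → ℝ), t)) (0, 1) 0 :=
      (hasDerivAt_const _ _).prodMk (hasDerivAt_id _)
    exact h2.comp_hasDerivAt (0 : ℝ) h3
  have hd' := hasDerivAt_comp_update (Fin.last m) ((hf.weaklySmooth hH).differentiableAt (by simp))
  have he : ∀ t, update (0 : Fin (m + 1) → ℝ) (Fin.last m) t = s (0, t) := fun t => by
    rw [update_last_eq_snoc]; rfl
  simp only [he, Pi.zero_apply] at hd'
  have hval := hd.unique hd'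
  have hinv : (fderiv ℝ (fun q => f (s q)) (0, 0) ∘L .inr ℝ (Fin m → ℝ) ℝ).IsInvertible := by
    refine ⟨ContinuousLinearEquiv.unitsEquivAut ℝ (Units.mk0 _ (hval ▸ h1)), ?_⟩
    ext
    simp
  refine ⟨hF.implicitFunction (by simp) hinv, ?_, hF.implicitFunction_apply_self (by simp) hinv, ?_⟩
  · refine GermAlg.implicit hf h0 h1 (hF.contDiffAt_implicitFunction (by simp) hinv)
      (hF.implicitFunction_apply_self (by simp) hinv) ?_
    simpa [hs0, h0, s] using hF.eventually_apply_implicitFunction (by simp) hinv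
  · simpa [hs0, h0, s] using hF.eventually_apply_implicitFunction (by simp) hinv

theorem tendsto_update_last {m : ℕ} :
    Tendsto (fun t : ℝ => update (0 : Fin (m + 1) → ℝ) (Fin.last m) t) (𝓝 0) (𝓝 0) := by
  have : Continuous (fun t : ℝ => update (0 : Fin (m + 1) → ℝ) (Fin.last m) t) := by fun_prop
  simpa using this.tendsto 0

theorem _root_.Polynomial.coeff_eq_zero_of_eventually_eval_eq {p : Polynomial ℝ} {d : ℕ} {w : ℝ → ℝ}
    (hw : ContinuousAt w 0) (h : ∀ᶠ t in 𝓝 (0 : ℝ), p.eval t = t ^ d * w t) :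
    ∀ k < d, p.coeff k = 0 := by
  intro k
  induction k using Nat.strong_induction_on with
  | _ k ih =>
    intro hk
    obtain ⟨q, rfl⟩ := Polynomial.X_pow_dvd_iff.2 fun j hj => ih j hj (hj.trans hk)
    have h1 : (Polynomial.X ^ k * q).coeff k = q.eval 0 := by
      have := Polynomial.coeff_X_pow_mul q k 0
      rwa [zero_add, Polynomial.coeff_zero_eq_eval_zero] at this
    rw [h1]
    have h2 : Tendsto (fun t => q.eval t) (𝓝[≠] 0) (𝓝 (q.eval 0)) :=
      q.continuous.continuousAt.tendsto.mono_left nhdsWithin_le_nhds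
    have h3 : Tendsto (fun t => t ^ (d - k) * w t) (𝓝[≠] (0 : ℝ)) (𝓝 0) := by
      have : ContinuousAt (fun t : ℝ => t ^ (d - k) * w t) 0 :=
        (continuousAt_id.pow (d - k)).mul hw
      simpa [ContinuousAt, (Nat.sub_pos_of_lt hk).ne'] using
        this.tendsto.mono_left nhdsWithin_le_nhds
    refine tendsto_nhds_unique h2 (h3.congr' ?_)
    filter_upwards [nhdsWithin_le_nhds h, self_mem_nhdsWithin] with t ht ht0
    have ht0' : t ^ k ≠ 0 := pow_ne_zero _ ht0
    refine mul_left_cancel₀ ht0' ?_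
    rw [← mul_assoc, ← pow_add, Nat.add_sub_cancel' hk.le, ← ht]
    simp

/-- If the restriction of a germ to the last axis is, up to order `d`, a polynomial with a nonzero
coefficient of degree less than `d`, then some derivative of order less than `d` is nonzero. -/
theorem GermAlg.exists_iterate_partialDeriv_ne_zero (hH : IsLeGalRolin H) {m d : ℕ}
    {f : (Fin (m + 1) → ℝ) → ℝ} (hf : GermAlg H (m + 1) f) (p : Polynomial ℝ) {w : ℝ → ℝ}
    (hw : ContinuousAt w 0)
    (hfp : ∀ᶠ t in 𝓝 (0 : ℝ), f (update 0 (Fin.last m) t) = p.eval t + t ^ d * w t)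
    {k : ℕ} (hk : k < d) (hp : p.coeff k ≠ 0) :
    ∃ j < d, (HSets.partialDeriv (Fin.last m))^[j] f 0 ≠ 0 := by
  by_contra! hcon
  obtain ⟨u, hu, -, hfu⟩ := hf.exists_taylor hH d
  have hus : ContinuousAt (fun t : ℝ => u (update 0 (Fin.last m) t)) 0 := by
    have h1 := (hu.continuousAt hH).tendsto.comp (tendsto_update_last (m := m))
    simpa [ContinuousAt] using! h1
  refine hp (Polynomial.coeff_eq_zero_of_eventually_eval_eq (hus.fun_sub hw) ?_ k hk)
  filter_upwards [hfp, tendsto_update_last.eventually hfu] with t h1 h2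
  have hz : update (0 : Fin (m + 1) → ℝ) (Fin.last m) 0 = 0 := by simp
  rw [h1, Finset.sum_eq_zero fun j hj => by
    rw [update_idem, hz, hcon j (Finset.mem_range.1 hj), zero_div, zero_mul]] at h2
  simp only [update_self] at h2
  linear_combination h2

/-- Every product of a germ with nonzero `d`-th derivative in the last variable and a nonzero germ
in the other variables is normalizable. -/
def NormalizesOrder (H : ℝ → ℝ) (m d : ℕ) : Prop :=
  ∀ f, GermAlg H (m + 1) f → (partialDeriv (Fin.last m))^[d] f 0 ≠ 0 →
    ∀ g, GermAlg H m g → (¬ g =ᶠ[𝓝 0] fun _ => 0) →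
      Normalizable H fun x : Fin (m + 1) → ℝ => g (Fin.init x) * f x

theorem monomial_update_mul {n : ℕ} (α : Fin n → ℕ) (x : Fin n → ℝ) (i : Fin n) (t : ℝ) :
    monomial α (update x i (t * x i)) = t ^ α i * monomial α x := by
  unfold monomial
  rw [← Finset.mul_prod_erase _ _ (Finset.mem_univ i),
    ← Finset.mul_prod_erase _ (fun j => x j ^ α j) (Finset.mem_univ i), update_self, mul_pow,
    mul_assoc]
  congr 2
  refine Finset.prod_congr rfl fun j hj => ?_
  rw [update_of_ne (Finset.ne_of_mem_erase hj)]

theorem GermAlg.comp_init {m : ℕ} {b : (Fin m → ℝ) → ℝ} (hb : GermAlg H m b) :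
    GermAlg H (m + 1) fun x => b (Fin.init x) := hb.comp_map IsAlgMap.init

/-- Blowing up `β` codimension two subspaces, each given by the vanishing of the last variable and
of another one, makes the order of regularity drop. The order stays below `e + 1` in the charts away
from the origin of the exceptional divisor because the term of degree `e` is absent. -/
theorem normalizable_of_prepared (hH : IsLeGalRolin H) {m e : ℕ}
    (IH : ∀ j < e + 1, NormalizesOrder H m j) (β : Fin m → ℕ) :
    ∀ (γ : Fin m → ℕ) (b : ℕ → (Fin m → ℝ) → ℝ) (u : (Fin (m + 1) → ℝ) → ℝ),
      (∀ i, GermAlg H m (b i)) → GermAlg H (m + 1) u → u 0 ≠ 0 → (∃ k < e, b k 0 ≠ 0) →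
      Normalizable H fun x : Fin (m + 1) → ℝ => monomial γ (Fin.init x) *
        ((∑ i ∈ Finset.range e, b i (Fin.init x) * monomial β (Fin.init x) ^ (e + 1 - i) *
          x (Fin.last m) ^ i) + x (Fin.last m) ^ (e + 1) * u x) := by
  induction β using exponent_induction with
  | zero =>
    rintro γ b u hb hu hu0 ⟨k, hk, hbk⟩
    have hf : GermAlg H (m + 1) fun x : Fin (m + 1) → ℝ =>
        (∑ i ∈ Finset.range e,
          b i (Fin.init x) * monomial (0 : Fin m → ℕ) (Fin.init x) ^ (e + 1 - i) *
            x (Fin.last m) ^ i) + x (Fin.last m) ^ (e + 1) * u x := by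
      refine (GermAlg.finset_sum _ fun i _ => ?_).sum (((GermAlg.coord _).pow _).prod hu)
      exact ((GermAlg.comp_init (hb i)).prod
        ((GermAlg.comp_init (germAlg_monomial 0)).pow _)).prod ((GermAlg.coord _).pow _)
    obtain ⟨j, hj, hj0⟩ := hf.exists_iterate_partialDeriv_ne_zero hH (d := e + 1) (k := k)
      (∑ i ∈ Finset.range e, Polynomial.C (b i 0) * Polynomial.X ^ i)
      (w := fun t => u (update 0 (Fin.last m) t)) (by
        have h1 := (hu.continuousAt hH).tendsto.comp (tendsto_update_last (m := m))
        simpa [ContinuousAt] using! h1)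
      (Eventually.of_forall fun t => by
        have : (Fin.init (update (0 : Fin (m + 1) → ℝ) (Fin.last m) t) : Fin m → ℝ) = 0 := by
          rw [Fin.init_update_last]; rfl
        simp [this, Polynomial.eval_finsetSum, monomial_zero])
      (by omega) (by simpa [Polynomial.finsetSum_coeff, Polynomial.coeff_X_pow, hk] using hbk)
    exact IH j hj _ hf hj0 _ (germAlg_monomial γ) (monomial_ne_zero hH γ)
  | add_single β l ih =>
    rintro γ b u hb hu hu0 hk
    have hne : l.castSucc ≠ Fin.last m := (Fin.castSucc_lt_last l).ne
    refine .blowUp (Fin.last m) l.castSucc hne.symm (fun c => ?_) ?_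
    · have hπ := isAlgMap_blowUpMap (H := H) (Fin.last m) l.castSucc c
      have hform : (fun x : Fin (m + 1) → ℝ =>
          monomial γ (Fin.init (blowUpMap (Fin.last m) l.castSucc c x)) *
          ((∑ i ∈ Finset.range e, b i (Fin.init (blowUpMap (Fin.last m) l.castSucc c x)) *
            monomial (β + Pi.single l 1) (Fin.init (blowUpMap (Fin.last m) l.castSucc c x)) ^
              (e + 1 - i) *
          blowUpMap (Fin.last m) l.castSucc c x (Fin.last m) ^ i) +
          blowUpMap (Fin.last m) l.castSucc c x (Fin.last m) ^ (e + 1) *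
            u (blowUpMap (Fin.last m) l.castSucc c x))) = fun x =>
          monomial (γ + Pi.single l (e + 1)) (Fin.init x) *
          ((∑ i ∈ Finset.range e, b i (Fin.init x) *
            monomial β (Fin.init x) ^ (e + 1 - i) * (c + x (Fin.last m)) ^ i) +
          (c + x (Fin.last m)) ^ (e + 1) * u (blowUpMap (Fin.last m) l.castSucc c x)) := by
        funext x
        have h1 : (Fin.init (blowUpMap (Fin.last m) l.castSucc c x) : Fin m → ℝ) = Fin.init x := by
          rw [blowUpMap, Fin.init_update_last]
        have h2 : blowUpMap (Fin.last m) l.castSucc c x (Fin.last m) =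
            x l.castSucc * (c + x (Fin.last m)) := by simp [blowUpMap]
        have h3 : (Fin.init x : Fin m → ℝ) l = x l.castSucc := rfl
        rw [h1, h2]
        simp only [monomial_add, monomial_single, h3]
        rw [mul_assoc (monomial γ (Fin.init x)), mul_add (x l.castSucc ^ (e + 1)), Finset.mul_sum]
        congr 2
        · refine Finset.sum_congr rfl fun i hi => ?_
          have : e + 1 = (e + 1 - i) + i := by have := Finset.mem_range.1 hi; omega
          rw [show x l.castSucc ^ (e + 1) = x l.castSucc ^ (e + 1 - i) * x l.castSucc ^ i by
            rw [← pow_add, ← this], mul_pow (x l.castSucc) (c + x (Fin.last m))]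
          ring
        · rw [mul_pow (x l.castSucc) (c + x (Fin.last m)), mul_assoc]
      rw [hform]
      by_cases hc : c = 0
      · subst hc
        simpa only [zero_add] using ih (γ + Pi.single l (e + 1)) b _ hb (hu.comp_map hπ)
          (by rw [hπ.2]; exact hu0) hk
      · have hf : GermAlg H (m + 1) fun x : Fin (m + 1) → ℝ =>
            (∑ i ∈ Finset.range e, b i (Fin.init x) *
            monomial β (Fin.init x) ^ (e + 1 - i) * (c + x (Fin.last m)) ^ i) +
          (c + x (Fin.last m)) ^ (e + 1) * u (blowUpMap (Fin.last m) l.castSucc c x) := by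
          have hct := (GermAlg.const (H := H) (m + 1) c).sum (GermAlg.coord (Fin.last m))
          refine (GermAlg.finset_sum _ fun i _ => ?_).sum ((hct.pow _).prod (hu.comp_map hπ))
          exact ((GermAlg.comp_init (hb i)).prod
            ((GermAlg.comp_init (germAlg_monomial β)).pow _)).prod (hct.pow _)
        obtain ⟨j, hj, hj0⟩ := hf.exists_iterate_partialDeriv_ne_zero hH (d := e + 1) (k := e)
          ((∑ i ∈ Finset.range e, Polynomial.C (b i 0 * monomial β 0 ^ (e + 1 - i)) *
            (Polynomial.X + Polynomial.C c) ^ i) +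
            Polynomial.C (u 0) * (Polynomial.X + Polynomial.C c) ^ (e + 1))
          (w := fun _ => 0) continuousAt_const
          (Eventually.of_forall fun t => by
            have h1 : (Fin.init (update (0 : Fin (m + 1) → ℝ) (Fin.last m) t) : Fin m → ℝ) = 0 := by
              rw [Fin.init_update_last]; rfl
            have h2 : blowUpMap (Fin.last m) l.castSucc c
                (update (0 : Fin (m + 1) → ℝ) (Fin.last m) t) = 0 := by
              simp [blowUpMap]
            simp only [h1, h2, update_self, Polynomial.eval_add, Polynomial.eval_finsetSum,
              Polynomial.eval_mul, Polynomial.eval_C, Polynomial.eval_pow, Polynomial.eval_X]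
            rw [mul_zero, add_zero, add_comm c t, mul_comm (u 0)])
          (by omega) (by
            rw [Polynomial.coeff_add, Polynomial.finsetSum_coeff, Finset.sum_eq_zero, zero_add,
              Polynomial.coeff_C_mul, Polynomial.coeff_X_add_C_pow]
            · have : ((e : ℝ) + 1) ≠ 0 := by positivity
              simp [hu0, hc, this]
            · intro i hi
              rw [Polynomial.coeff_C_mul, Polynomial.coeff_X_add_C_pow,
                Nat.choose_eq_zero_of_lt (Finset.mem_range.1 hi)]
              simp)
        exact IH j hj _ hf hj0 _ (germAlg_monomial _) (monomial_ne_zero hH _)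
    · have hπ := isAlgMap_blowUpMap (H := H) l.castSucc (Fin.last m) 0
      have hinit : ∀ x : Fin (m + 1) → ℝ,
          (Fin.init (blowUpMap l.castSucc (Fin.last m) 0 x) : Fin m → ℝ) =
          update (Fin.init x) l (x (Fin.last m) * (Fin.init x : Fin m → ℝ) l) := fun x => by
        rw [blowUpMap, Fin.init_update_castSucc, zero_add]; rfl
      have hlast : ∀ x : Fin (m + 1) → ℝ,
          blowUpMap l.castSucc (Fin.last m) 0 x (Fin.last m) = x (Fin.last m) := fun x => by
        rw [blowUpMap, update_of_ne hne.symm]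
      let U : (Fin (m + 1) → ℝ) → ℝ := fun x =>
        (∑ i ∈ Finset.range e, b i (Fin.init (blowUpMap l.castSucc (Fin.last m) 0 x)) *
          (x (Fin.last m) ^ β l * (monomial β (Fin.init x) * x l.castSucc)) ^ (e + 1 - i)) +
        u (blowUpMap l.castSucc (Fin.last m) 0 x)
      have hU : GermAlg H (m + 1) U := by
        refine (GermAlg.finset_sum _ fun i _ => ?_).sum (hu.comp_map hπ)
        exact ((hb i).comp_map (IsAlgMap.init.comp hπ)).prod ((((GermAlg.coord _).pow _).prod
          ((GermAlg.comp_init (germAlg_monomial β)).prod (GermAlg.coord _))).pow _)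
      have hU0 : U 0 ≠ 0 := by
        simp only [U, hπ.2]
        rw [Finset.sum_eq_zero, zero_add]
        · exact hu0
        · intro i hi
          have : e + 1 - i ≠ 0 := by have := Finset.mem_range.1 hi; omega
          simp [this]
      refine .of_isMonomialUnit ((((IsMonomialUnit.coord_pow (Fin.last m) (γ l)).mul
        (IsMonomialUnit.comp_init hH (f := monomial γ)
          ⟨γ, fun _ => 1, GermAlg.const m 1, one_ne_zero, by simp⟩)).mul
        ((IsMonomialUnit.coord_pow (Fin.last m) (e + 1)).mul
        (IsMonomialUnit.of_apply_ne_zero hU hU0))).congr (Eventually.of_forall fun x => ?_))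
      simp only [hlast, U]
      rw [hinit, monomial_update_mul, monomial_update_mul]
      have h3 : (Fin.init x : Fin m → ℝ) l = x l.castSucc := rfl
      simp only [monomial_add, monomial_single, h3, Pi.add_apply, Pi.single_eq_same]
      rw [mul_add, Finset.mul_sum]
      congr 2
      refine Finset.sum_congr rfl fun i hi => ?_
      have : e + 1 = (e + 1 - i) + i := by have := Finset.mem_range.1 hi; omega
      rw [show x (Fin.last m) ^ (e + 1) = x (Fin.last m) ^ (e + 1 - i) * x (Fin.last m) ^ i by
        rw [← pow_add, ← this]]
      ring

/-! ### Every nonzero germ is normalizable -/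

theorem isAlgMap_ramifyAll {m N : ℕ} (hN : 0 < N) (ε : Fin m → ℝ) :
    IsAlgMap H fun (y : Fin m → ℝ) l => ε l * y l ^ N :=
  ⟨fun l => (GermAlg.const m (ε l)).prod ((GermAlg.coord l).pow N),
    funext fun l => by simp [hN.ne']⟩

theorem monomial_ramifyAll {m : ℕ} (α : Fin m → ℕ) (N : ℕ) (ε y : Fin m → ℝ) :
    monomial α (fun l => ε l * y l ^ N) = monomial α ε * monomial α y ^ N := by
  simp only [monomial, mul_pow, Finset.prod_mul_distrib, ← Finset.prod_pow]
  congr 1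
  exact Finset.prod_congr rfl fun i _ => by rw [← pow_mul, ← pow_mul, mul_comm]

theorem abs_monomial_sign {m : ℕ} (α : Fin m → ℕ) {ε : Fin m → ℝ}
    (hε : ∀ l, ε l = 1 ∨ ε l = -1) : |monomial α ε| = 1 := by
  rw [monomial, Finset.abs_prod]
  refine Finset.prod_eq_one fun i _ => ?_
  rcases hε i with h | h <;> simp [h]

/-- The even exponent by which the coefficient of degree `i` is raised: if `aᵢ` is divisible by
`M ^ (e + 1 - i)` for all `i`, then `aᵢ ^ weight e i` is divisible by the same power
`M ^ (2 (e + 1)!)` for all `i`. -/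
def weight (e i : ℕ) : ℕ := 2 * ((e + 1).factorial / (e + 1 - i))

theorem weight_mul {e i : ℕ} (hi : i < e) : weight e i * (e + 1 - i) = 2 * (e + 1).factorial := by
  rw [weight, mul_assoc, Nat.div_mul_cancel (Nat.dvd_factorial (by omega) (by omega))]

theorem weight_pos {e i : ℕ} (hi : i < e) : 0 < weight e i := by
  refine Nat.pos_of_ne_zero fun h => ?_
  have h1 := weight_mul hi
  rw [h, zero_mul] at h1
  have := Nat.factorial_pos (e + 1)
  omega

theorem even_weight (e i : ℕ) : Even (weight e i) := even_two_mul _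

/-- After a ramification, a monomial sum of even powers of the coefficients yields a monomial whose
powers divide all coefficients, one of the quotients being a unit. -/
theorem normalizable_of_isMonomialUnit_sum (hH : IsLeGalRolin H) {m e : ℕ}
    (IH : ∀ j < e + 1, NormalizesOrder H m j) {g : (Fin m → ℝ) → ℝ} {a : ℕ → (Fin m → ℝ) → ℝ}
    {u : (Fin (m + 1) → ℝ) → ℝ} (ha : ∀ i, GermAlg H m (a i)) (hu : GermAlg H (m + 1) u)
    (hu0 : u 0 ≠ 0) (hg : IsMonomialUnit H g)
    (hS : IsMonomialUnit H fun y => ∑ i ∈ Finset.range e, a i y ^ weight e i) :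
    Normalizable H fun x : Fin (m + 1) → ℝ => g (Fin.init x) *
      ((∑ i ∈ Finset.range e, a i (Fin.init x) * x (Fin.last m) ^ i) +
        x (Fin.last m) ^ (e + 1) * u x) := by
  obtain ⟨γ, w, hw, hw0, hgw⟩ := hg
  obtain ⟨σ, v, hv, hv0, hSv⟩ := hS
  set N := 2 * (e + 1).factorial with hNdef
  have hN : 0 < N := by positivity
  refine .ramify_all hN fun ε hε => ?_
  set R : (Fin m → ℝ) → (Fin m → ℝ) := fun y l => ε l * y l ^ N with hRdef
  have hR : IsAlgMap H R := isAlgMap_ramifyAll hN ε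
  have hSR : (fun y => ∑ i ∈ Finset.range e, a i (R y) ^ weight e i) =ᶠ[𝓝 0] fun y =>
      monomial σ y ^ N * (monomial σ ε * v (R y)) := by
    filter_upwards [hSv.comp_algMap hH hR] with y hy
    rw [hy, hRdef, monomial_ramifyAll]
    ring
  have hvR := hv.comp_map hR
  have hdiv : ∀ i : ℕ, ∃ b, GermAlg H m b ∧ (i < e → (fun y => a i (R y)) =ᶠ[𝓝 0] fun y =>
      monomial σ y ^ (e + 1 - i) * b y) := by
    intro i
    by_cases hi : i < e
    swap
    · exact ⟨fun _ => 0, GermAlg.const m 0, fun h => absurd h hi⟩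
    obtain ⟨b, hb, hab⟩ := ((ha i).comp_map hR).exists_eq_monomial_mul hH ((e + 1 - i) • σ)
      (|v (R 0)| + 1) (by
      have hlt := (hvR.continuousAt hH).abs.eventually_lt continuousAt_const
        (lt_add_one |v (R 0)|)
      filter_upwards [hSR, hlt] with y h1 h2
      set C := |v (R 0)| + 1
      have hC : 1 ≤ C := by simp [C]
      rw [monomial_nsmul, abs_pow]
      refine (pow_le_pow_iff_left₀ (abs_nonneg _) (by positivity) (weight_pos hi).ne').1 ?_
      calc |a i (R y)| ^ weight e i = a i (R y) ^ weight e i := (even_weight e i).pow_abs _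
        _ ≤ ∑ i ∈ Finset.range e, a i (R y) ^ weight e i :=
            Finset.single_le_sum (f := fun i => a i (R y) ^ weight e i)
              (fun j _ => (even_weight e j).pow_nonneg _) (Finset.mem_range.2 hi)
        _ = monomial σ y ^ N * (monomial σ ε * v (R y)) := h1
        _ ≤ |monomial σ y ^ N * (monomial σ ε * v (R y))| := le_abs_self _
        _ = |monomial σ y| ^ N * |v (R y)| := by
            rw [abs_mul, abs_mul, abs_monomial_sign σ hε, one_mul, abs_pow]
        _ ≤ |monomial σ y| ^ N * C ^ weight e i := by
            gcongr
            exact h2.le.trans (le_self_pow₀ hC (weight_pos hi).ne')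
        _ = (C * |monomial σ y| ^ (e + 1 - i)) ^ weight e i := by
            rw [mul_pow, ← pow_mul, mul_comm (e + 1 - i), weight_mul hi]
            ring)
    exact ⟨b, hb, fun _ => by simpa only [monomial_nsmul] using hab⟩
  choose b hb hab using hdiv
  have hall : ∀ᶠ y in 𝓝 (0 : Fin m → ℝ), ∀ i ∈ Finset.range e,
      a i (R y) = monomial σ y ^ (e + 1 - i) * b i y :=
    (Finset.eventually_all _).2 fun i hi => hab i (Finset.mem_range.1 hi)
  have hsum : (fun y => ∑ i ∈ Finset.range e, b i y ^ weight e i) =ᶠ[𝓝 0] fun y =>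
      monomial σ ε * v (R y) := by
    refine ((germAlg_monomial σ).pow N).mul_left_cancel hH
      ((germAlg_monomial σ).pow_ne_zero hH (monomial_ne_zero hH σ) N)
      (GermAlg.finset_sum _ fun i _ => (hb i).pow _) (hvR.const_mul _) ?_
    filter_upwards [hSR, hall] with y h1 h2
    rw [← h1, Finset.mul_sum]
    refine Finset.sum_congr rfl fun i hi => ?_
    rw [h2 i hi, mul_pow, ← pow_mul, mul_comm (e + 1 - i), weight_mul (Finset.mem_range.1 hi)]
  have hbk : ∃ k < e, b k 0 ≠ 0 := by
    by_contra! hcon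
    have h1 := hsum.eq_of_nhds
    rw [Finset.sum_eq_zero fun i hi => by
      rw [hcon i (Finset.mem_range.1 hi), zero_pow (weight_pos (Finset.mem_range.1 hi)).ne']] at h1
    have h2 : monomial σ ε ≠ 0 := fun h => by simpa [h] using abs_monomial_sign σ hε
    refine mul_ne_zero h2 ?_ h1.symm
    rw [hR.2]; exact hv0
  have hcε : monomial γ ε ≠ 0 := fun h => by simpa [h] using abs_monomial_sign γ hε
  have hwR : GermAlg H m fun y => monomial γ ε * w (R y) := (hw.comp_map hR).const_mul _
  obtain ⟨k, hk, hk0⟩ := hbk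
  have hwR0 : monomial γ ε * w (R 0) ≠ 0 := mul_ne_zero hcε (by rw [hR.2]; exact hw0)
  refine (normalizable_of_prepared hH IH σ (N • γ) (fun i y => monomial γ ε * w (R y) * b i y)
    (fun x => monomial γ ε * w (R (Fin.init x)) * u (liftMap R x)) (fun i => hwR.prod (hb i))
    ((hwR.comp_map IsAlgMap.init).prod (hu.comp_map (isAlgMap_liftMap hR)))
    (mul_ne_zero hwR0 (by rw [(isAlgMap_liftMap hR).2]; exact hu0))
    ⟨k, hk, mul_ne_zero hwR0 hk0⟩).congr hH ?_
  filter_upwards [(IsAlgMap.init.tendsto hH).eventually hall,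
    (hgw.comp_algMap hH hR).comp_algMap hH IsAlgMap.init] with x h1 h2
  simp only [init_liftMap, liftMap_last]
  have h3 : monomial γ (R (Fin.init x)) = monomial γ ε * monomial γ (Fin.init x) ^ N :=
    monomial_ramifyAll γ N ε _
  rw [h2, h3, monomial_nsmul, mul_add, mul_add, Finset.mul_sum, Finset.mul_sum]
  congr 1
  · refine Finset.sum_congr rfl fun i hi => ?_
    rw [h1 i hi]; ring
  · ring

theorem normalizesOrder (hH : IsLeGalRolin H) {m : ℕ}
    (hT : ∀ g, GermAlg H m g → (¬ g =ᶠ[𝓝 0] fun _ => 0) → Normalizable H g) (d : ℕ) :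
    NormalizesOrder H m d := by
  induction d using Nat.strong_induction_on with
  | _ d IH =>
  intro f hf hd g hg hg0
  -- A factor depending only on the first variables is normalized in these variables.
  have hunit : ∀ (k : ℕ) (u : (Fin (m + 1) → ℝ) → ℝ), GermAlg H (m + 1) u → u 0 ≠ 0 →
      Normalizable H fun x : Fin (m + 1) → ℝ => g (Fin.init x) * (x (Fin.last m) ^ k * u x) := by
    intro k u hu hu0
    refine (hT g hg hg0).extend fun ρ hρ hgρ => .of_isMonomialUnit ?_
    simp only [init_liftMap, liftMap_last]
    exact (hgρ.comp_init hH).mul ((IsMonomialUnit.coord_pow _ k).mul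
      (.of_apply_ne_zero (hu.comp_map (isAlgMap_liftMap hρ))
        (by rw [(isAlgMap_liftMap hρ).2]; exact hu0)))
  by_cases hlow : ∃ j < d, (partialDeriv (Fin.last m))^[j] f 0 ≠ 0
  · obtain ⟨j, hj, hj0⟩ := hlow
    exact IH j hj f hf hj0 g hg hg0
  push Not at hlow
  rcases d with _ | e
  · simpa using hunit 0 f hf hd
  -- The translation to the zero of the derivative of order `e` kills the coefficient of degree `e`.
  obtain ⟨φ, hφ, hφ0, hfφ⟩ := (hf.iterate_partialDeriv hH (Fin.last m) e).exists_implicit hH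
    (hlow e (Nat.lt_succ_self e)) (by rwa [← iterate_succ_apply' (partialDeriv (Fin.last m))])
  have hφ' := GermAlg.comp_init hφ
  have hφi : ∀ (x : Fin (m + 1) → ℝ) (s : ℝ),
      φ (Fin.init (update x (Fin.last m) s)) = φ (Fin.init x) := fun x s => by
    rw [Fin.init_update_last]
  refine .translate (Fin.last m) (fun x => φ (Fin.init x)) hφ' hφi hφ0 ?_
  have hT' := isAlgMap_translateMap (Fin.last m) hφ' hφ0
  have hinit : ∀ x : Fin (m + 1) → ℝ, (Fin.init (translateMap (Fin.last m)
      (fun x => φ (Fin.init x)) x) : Fin m → ℝ) = Fin.init x := fun x => by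
    rw [translateMap, Fin.init_update_last]
  simp only [hinit]
  set F : (Fin (m + 1) → ℝ) → ℝ := fun x =>
    f (translateMap (Fin.last m) (fun x => φ (Fin.init x)) x)
    with hFdef
  have hF : GermAlg H (m + 1) F := hf.comp_map hT'
  have hDF : ∀ k, (partialDeriv (Fin.last m))^[k] F =ᶠ[𝓝 0] fun x =>
      (partialDeriv (Fin.last m))^[k] f (translateMap (Fin.last m) (fun x => φ (Fin.init x)) x) :=
    fun k =>
    hf.iterate_partialDeriv_comp_translateMap hH (Fin.last m) hφ' hφi hφ0 k
  obtain ⟨u, hu, hu0, hFu⟩ := hF.exists_taylor hH (e + 1)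
  have hu0' : u 0 ≠ 0 := by
    rw [hu0, (hDF (e + 1)).eq_of_nhds, hT'.2]
    exact div_ne_zero hd (by positivity)
  let a : ℕ → (Fin m → ℝ) → ℝ := fun j y =>
    (partialDeriv (Fin.last m))^[j] F (Fin.snoc (α := fun _ => ℝ) y 0) / j.factorial
  have ha : ∀ j, GermAlg H m (a j) := fun j => by
    simpa only [a, div_eq_inv_mul] using
      ((hF.iterate_partialDeriv hH (Fin.last m) j).comp_map IsAlgMap.snoc_zero).const_mul _
  have hae : a e =ᶠ[𝓝 0] fun _ => 0 := by
    filter_upwards [(hDF e).comp_algMap hH IsAlgMap.snoc_zero, hfφ] with y h1 h2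
    simp only [a, h1, translateMap, update_last_eq_snoc, Fin.init_snoc, Fin.snoc_last, zero_add, h2,
      zero_div]
  have hFa : F =ᶠ[𝓝 0] fun x => (∑ j ∈ Finset.range e, a j (Fin.init x) * x (Fin.last m) ^ j) +
      x (Fin.last m) ^ (e + 1) * u x := by
    filter_upwards [hFu, hae.comp_algMap hH IsAlgMap.init] with x h1 h2
    rw [h1]
    simp only [update_last_eq_snoc]
    rw [Finset.sum_range_succ]
    have : (partialDeriv (Fin.last m))^[e] F (Fin.snoc (α := fun _ => ℝ) (Fin.init x) 0) /
      e.factorial = 0 := h2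
    rw [this, zero_mul, add_zero]
  refine Normalizable.congr hH (f := fun x => g (Fin.init x) *
    ((∑ j ∈ Finset.range e, a j (Fin.init x) * x (Fin.last m) ^ j) +
      x (Fin.last m) ^ (e + 1) * u x)) ?_ (by
    filter_upwards [hFa] with x hx
    rw [← hx])
  have hSA : GermAlg H m fun y => ∑ i ∈ Finset.range e, a i y ^ weight e i :=
    GermAlg.finset_sum _ fun i _ => (ha i).pow _
  by_cases hS : (fun y => ∑ i ∈ Finset.range e, a i y ^ weight e i) =ᶠ[𝓝 0] fun _ => 0
  · refine (hunit (e + 1) u hu hu0').congr hH ?_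
    filter_upwards [hS.comp_algMap hH IsAlgMap.init] with x hx
    have h1 := (Finset.sum_eq_zero_iff_of_nonneg fun i _ => (even_weight e i).pow_nonneg _).1 hx
    rw [Finset.sum_eq_zero fun i hi => by
      rw [pow_eq_zero_iff (weight_pos (Finset.mem_range.1 hi)).ne' |>.1 (h1 i hi), zero_mul],
      zero_add]
  · refine (hT _ (hg.prod hSA) (hg.mul_ne_zero hH hSA hg0 hS)).extend fun ρ hρ hGρ => ?_
    simp only [init_liftMap, liftMap_last]
    have hgρ := hg.comp_map hρ
    have hSρ := hSA.comp_map hρ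
    exact normalizable_of_isMonomialUnit_sum hH IH
      (g := fun y => g (ρ y)) (a := fun i y => a i (ρ y))
      (fun i => (ha i).comp_map hρ) (hu.comp_map (isAlgMap_liftMap hρ))
      (by rw [(isAlgMap_liftMap hρ).2]; exact hu0') (.of_mul hH hgρ hSρ hGρ)
      (.of_mul hH hSρ hgρ (by simpa only [mul_comm] using hGρ))

/-- Every nonzero germ of the algebra is normalizable. -/
theorem GermAlg.normalizable (hH : IsLeGalRolin H) {n : ℕ} {f : (Fin n → ℝ) → ℝ}
    (hf : GermAlg H n f) (h0 : ¬ f =ᶠ[𝓝 0] fun _ => 0) : Normalizable H f := by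
  induction n with
  | zero =>
    exact .of_isMonomialUnit (.of_apply_ne_zero hf fun h =>
      h0 (eventuallyEq_nhds_zero_of_fin_zero h))
  | succ m ih =>
    obtain ⟨N, hN, d, hd⟩ := hf.exists_regular hH h0
    refine .translate_pow N hN ?_
    have hT : IsAlgMap H fun x : Fin (m + 1) → ℝ => (Fin.snoc (α := fun _ => ℝ)
        (fun k => x k.castSucc + x (Fin.last m) ^ N k) (x (Fin.last m)) : Fin (m + 1) → ℝ) :=
      IsAlgMap.snoc ⟨fun k => (coord _).sum ((coord _).pow _),
        funext fun k => by simp [(hN k).ne']⟩ (coord _) rfl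
    simpa using normalizesOrder hH (fun g hg hg0 => ih hg hg0) d _ (hf.comp_map hT) hd
      (fun _ => 1) (const m 1) (ne_zero_of_apply_ne_zero (u := fun _ => 1) one_ne_zero)

/-! ### Local uniformization by sub-quadrants -/

theorem polydisk_mem_nhds {n : ℕ} {r : Fin n → ℝ} (hr : ∀ i, 0 < r i) :
    polydisk r ∈ 𝓝 (0 : Fin n → ℝ) := by
  have : polydisk r = Set.pi univ fun i => Ioo (-r i) (r i) := by
    ext x; simp [polydisk]
  rw [this]
  exact set_pi_mem_nhds finite_univ fun i _ => Ioo_mem_nhds (by simpa using hr i) (hr i)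

theorem exists_polydisk_subset {n : ℕ} {U : Set (Fin n → ℝ)} (hU : U ∈ 𝓝 (0 : Fin n → ℝ)) :
    ∃ δ : ℝ, 0 < δ ∧ polydisk (fun _ : Fin n => δ) ⊆ U := by
  obtain ⟨δ, hδ, hb⟩ := Metric.mem_nhds_iff.1 hU
  refine ⟨δ, hδ, fun x hx => hb ?_⟩
  rw [mem_ball_zero_iff, pi_norm_lt_iff hδ]
  exact fun i => abs_lt.2 (hx i)

theorem polydisk_mono {n : ℕ} {r r' : Fin n → ℝ} (h : ∀ i, r i ≤ r' i) :
    polydisk r ⊆ polydisk r' := fun _ hx i =>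
  ⟨by linarith [(hx i).1, h i], (hx i).2.trans_le (h i)⟩

theorem ElementaryFormula.mono {n : ℕ} {r r' : Fin n → ℝ} {ν : (Fin n → ℝ) → (Fin n → ℝ)}
    (hν : ElementaryFormula H n r' ν) (h : ∀ i, r i ≤ r' i) : ElementaryFormula H n r ν := by
  cases hν with
  | blowUp i j hij c => exact .blowUp i j hij c
  | tschirnhausen k hk h0 =>
    exact .tschirnhausen k ⟨hk.1.mono (polydisk_mono fun i => h _), hk.2⟩ h0
  | shear i c => exact .shear i c
  | ramification i d hd ε hε => exact .ramification i d hd ε hε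

/-- Near `0`, arbitrarily close to it, space is covered by finitely many images of sub-quadrants
under admissible transformations on each of which every function of the family has constant sign. -/
def Uniformizable (H : ℝ → ℝ) {n : ℕ} {κ : Type} (F : κ → (Fin n → ℝ) → ℝ) : Prop :=
  ∀ r : Fin n → ℝ, (∀ i, 0 < r i) → ∃ (ι : Type) (_ : Finite ι) (Q : ι → Set (Fin n → ℝ))
    (ρ : ι → (Fin n → ℝ) → (Fin n → ℝ)),
    (∀ i, IsSubQuadrant (Q i) ∧ ∃ r', IsAdmissible H r' r (ρ i) ∧ Q i ⊆ polydisk r') ∧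
    (⋃ i, ρ i '' Q i) ∈ 𝓝 (0 : Fin n → ℝ) ∧
    ∀ i k, ∃ s : SignType, ∀ x ∈ Q i, SignType.sign (F k (ρ i x)) = s

namespace Uniformizable

variable {n : ℕ} {κ : Type} {F : κ → (Fin n → ℝ) → ℝ}

/-- Uniformizability can be tested after pulling back by elementary transformations such that
finitely many of the images of any choice of neighbourhoods of `0` cover a neighbourhood of `0`. -/
theorem of_cover {ι : Type} (ν : ι → (Fin n → ℝ) → (Fin n → ℝ))
    (hν : ∀ a, ∃ r₀ : Fin n → ℝ, (∀ i, 0 < r₀ i) ∧ ElementaryFormula H n r₀ (ν a))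
    (hcont : ∀ a, Tendsto (ν a) (𝓝 0) (𝓝 0))
    (hcov : ∀ U : ι → Set (Fin n → ℝ), (∀ a, U a ∈ 𝓝 (0 : Fin n → ℝ)) →
      ∃ s : Set ι, s.Finite ∧ (⋃ a ∈ s, ν a '' U a) ∈ 𝓝 (0 : Fin n → ℝ))
    (hF : ∀ a, Uniformizable H fun k x => F k (ν a x)) : Uniformizable H F := by
  intro r hr
  have hr' : ∀ a, ∃ r' : Fin n → ℝ, (∀ i, 0 < r' i) ∧ IsElementary H r' r (ν a) := by
    intro a
    obtain ⟨r₀, hr₀, hνa⟩ := hν a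
    obtain ⟨δ, hδ, hsub⟩ := exists_polydisk_subset ((hcont a) (polydisk_mem_nhds hr))
    have hpos : ∀ i, 0 < min δ (r₀ i) := fun i => lt_min hδ (hr₀ i)
    exact ⟨fun i => min δ (r₀ i), hpos, hpos, hr,
      fun x hx => hsub (polydisk_mono (fun i => min_le_left _ _) hx),
      hνa.mono fun i => min_le_right _ _⟩
  choose r' hr'pos hel using hr'
  choose J hJ Q ρ hQ hcovJ hsign using fun a => hF a (r' a) (hr'pos a)
  obtain ⟨s, hs, hsU⟩ := hcov _ hcovJ
  have := hs.to_subtype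
  refine ⟨Σ a : s, J a, inferInstance, fun p => Q p.1 p.2, fun p => ν p.1 ∘ ρ p.1 p.2,
    fun p => ⟨(hQ _ _).1, ?_⟩, ?_, fun p k => hsign _ p.2 k⟩
  · obtain ⟨r'', hadm, hsub⟩ := (hQ p.1 p.2).2
    exact ⟨r'', .comp (hel p.1) hadm, hsub⟩
  · refine mem_of_superset hsU fun x hx => ?_
    simp only [mem_iUnion, mem_image] at hx
    obtain ⟨a, ha, y, ⟨j, z, hz, rfl⟩, rfl⟩ := hx
    exact mem_iUnion.2 ⟨⟨⟨a, ha⟩, j⟩, z, hz, rfl⟩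

theorem of_rightInverse {r₀ : Fin n → ℝ} (hr₀ : ∀ i, 0 < r₀ i) {ν μ : (Fin n → ℝ) → (Fin n → ℝ)}
    (hν : ElementaryFormula H n r₀ ν) (hcont : Tendsto ν (𝓝 0) (𝓝 0))
    (hμ : Tendsto μ (𝓝 0) (𝓝 0)) (hνμ : ∀ x, ν (μ x) = x)
    (hF : Uniformizable H fun k x => F k (ν x)) : Uniformizable H F :=
  of_cover (ι := Unit) (fun _ => ν) (fun _ => ⟨r₀, hr₀, hν⟩) (fun _ => hcont)
    (fun _ hU => ⟨univ, finite_univ, mem_of_superset (hμ (hU ())) fun x hx =>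
      mem_iUnion₂.2 ⟨(), mem_univ _, μ x, hx, hνμ x⟩⟩) fun _ => hF

theorem translateMap_neg (i : Fin n) {h : (Fin n → ℝ) → ℝ} (hi : ∀ x s, h (update x i s) = h x)
    (x : Fin n → ℝ) : translateMap i h (translateMap i (fun x => -h x) x) = x := by
  simp [translateMap, hi]

theorem translate_last (hH : IsLeGalRolin H) {m : ℕ} {F : κ → (Fin (m + 1) → ℝ) → ℝ}
    {h : (Fin (m + 1) → ℝ) → ℝ} (hh : GermAlg H (m + 1) h)
    (hi : ∀ x s, h (update x (Fin.last m) s) = h x) (h0 : h 0 = 0)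
    (hF : Uniformizable H fun k x => F k (translateMap (Fin.last m) h x)) : Uniformizable H F := by
  have hh' := hh.comp_map IsAlgMap.snoc_zero
  obtain ⟨δ, hδ, hsub⟩ := exists_polydisk_subset (hh'.eventually_continuousAt hH)
  have heq : translateMap (Fin.last m) h = fun x => update x (Fin.last m) (x (Fin.last m) +
      h (Fin.snoc (α := fun _ => ℝ) (fun k => x k.castSucc) 0)) := by
    funext x
    rw [translateMap, ← hi x 0, update_last_eq_snoc x 0]
    rfl
  refine of_rightInverse (r₀ := fun _ => δ) (fun _ => hδ) ?_
    ((isAlgMap_translateMap (Fin.last m) hh h0).tendsto hH)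
    ((isAlgMap_translateMap (Fin.last m) hh.neg (by simp [h0])).tendsto hH)
    (translateMap_neg _ hi) hF
  rw [heq]
  exact .tschirnhausen (fun y => h (Fin.snoc (α := fun _ => ℝ) y 0))
    ⟨fun y hy => ContinuousAt.continuousWithinAt
      (f := fun y => h (Fin.snoc (α := fun _ => ℝ) y 0)) (hsub hy), hh'⟩
    ((congrArg h (IsAlgMap.snoc_zero (H := H)).2).trans h0)

/-- Exchanging a variable with the last one is, up to the sign of the last variable, the composition
of three unipotent transformations, all of them elementary. -/
theorem swap_last (hH : IsLeGalRolin H) {m : ℕ} {F : κ → (Fin (m + 1) → ℝ) → ℝ}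
    {i : Fin (m + 1)} (hne : i ≠ Fin.last m)
    (hF : Uniformizable H fun k x => F k (x ∘ Equiv.swap i (Fin.last m))) : Uniformizable H F := by
  have hlt : i < Fin.last m := Fin.lt_last_iff_ne_last.2 hne
  have hshear : ∀ {F : κ → (Fin (m + 1) → ℝ) → ℝ},
      (Uniformizable H fun k x => F k (translateMap i (fun x => x (Fin.last m)) x)) →
      Uniformizable H F := by
    intro F hF
    have hi : ∀ (x : Fin (m + 1) → ℝ) (s : ℝ), update x i s (Fin.last m) = x (Fin.last m) :=
      fun x s => update_of_ne hne.symm _ _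
    refine of_rightInverse (r₀ := fun _ => 1) (fun _ => one_pos) ?_
      ((isAlgMap_translateMap i (GermAlg.coord (Fin.last m)) rfl).tendsto hH)
      ((isAlgMap_translateMap i (GermAlg.coord (Fin.last m)).neg (by simp)).tendsto hH)
      (translateMap_neg i hi) hF
    have : translateMap i (fun x => x (Fin.last m)) = fun x k =>
        if k < Fin.last m then x k + (Pi.single i 1 : Fin (m + 1) → ℝ) k * x (Fin.last m)
        else x k := by
      funext x k
      by_cases hk : k = i
      · subst hk; simp [translateMap, hlt]
      · simp [translateMap, hk]
    rw [this]
    exact .shear _ _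
  have hsign : (Uniformizable H fun k x => F k (ramifyMap (Fin.last m) 1 (-1) x)) →
      Uniformizable H F := by
    intro hF
    have ht := (isAlgMap_ramifyMap (H := H) (Fin.last m) one_pos (-1)).tendsto hH
    exact of_rightInverse (r₀ := fun _ => 1) (fun _ => one_pos)
      (.ramification (Fin.last m) 1 one_pos (-1) (Or.inr rfl)) ht ht
      (fun x => by simp [ramifyMap]) hF
  refine hsign (hshear (translate_last hH (GermAlg.coord i).neg
    (fun x s => by rw [update_of_ne hne]) (by simp) (hshear ?_)))
  convert hF using 3 with k x
  congr 1
  ext j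
  by_cases hj : j = i
  · subst hj; simp [translateMap, ramifyMap, hne, hne.symm]
  · by_cases hj' : j = Fin.last m
    · subst hj'; simp [translateMap, ramifyMap, hne, hne.symm]
    · simp [translateMap, ramifyMap, hj, hj', Equiv.swap_apply_of_ne_of_ne hj hj']

theorem translate (hH : IsLeGalRolin H) (i : Fin n) {h : (Fin n → ℝ) → ℝ} (hh : GermAlg H n h)
    (hi : ∀ x s, h (update x i s) = h x) (h0 : h 0 = 0)
    (hF : Uniformizable H fun k x => F k (translateMap i h x)) : Uniformizable H F := by
  rcases n with _ | m
  · exact i.elim0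
  by_cases hne : i = Fin.last m
  · subst hne; exact translate_last hH hh hi h0 hF
  have hσ : IsAlgMap H fun x : Fin (m + 1) → ℝ => x ∘ Equiv.swap i (Fin.last m) :=
    ⟨fun j => GermAlg.coord _, rfl⟩
  have hupd : ∀ (x : Fin (m + 1) → ℝ) (s : ℝ), update x (Fin.last m) s ∘ Equiv.swap i (Fin.last m) =
      update (x ∘ Equiv.swap i (Fin.last m)) i s := fun x s => by
    rw [update_comp_equiv]; simp
  refine swap_last hH hne (translate_last hH (hh.comp_map hσ)
    (fun x s => by rw [hupd, hi]) ((congrArg h hσ.2).trans h0) (swap_last hH hne ?_))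
  convert hF using 3 with k x
  congr 1
  have hinv : (x ∘ Equiv.swap i (Fin.last m)) ∘ Equiv.swap i (Fin.last m) = x := by
    ext j; simp
  rw [translateMap, hupd, hinv, translateMap]
  simp

theorem blowUp (hH : IsLeGalRolin H) {i j : Fin n} (hij : i ≠ j)
    (h : ∀ c, Uniformizable H fun k x => F k (blowUpMap i j c x))
    (h' : Uniformizable H fun k x => F k (blowUpMap j i 0 x)) : Uniformizable H F := by
  let ν : Option ℝ → (Fin n → ℝ) → (Fin n → ℝ) := fun a =>
    a.elim (blowUpMap j i 0) (blowUpMap i j)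
  refine of_cover ν (fun a => ⟨fun _ => 1, fun _ => one_pos, ?_⟩) (fun a => ?_) ?_ (fun a => ?_)
  · cases a with
    | none => exact .blowUp j i hij.symm 0
    | some c => exact .blowUp i j hij c
  · cases a with
    | none => exact (isAlgMap_blowUpMap j i 0).tendsto hH
    | some c => exact (isAlgMap_blowUpMap i j c).tendsto hH
  swap
  · cases a with
    | none => exact h'
    | some c => exact h c
  -- Compactness of the projective line of slopes leaves finitely many charts.
  intro U hU
  choose δ hδ hsub using fun a => exists_polydisk_subset (hU a)
  obtain ⟨t, -, ht⟩ := (isCompact_Icc (a := -(δ none)⁻¹) (b := (δ none)⁻¹)).elim_nhds_subcover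
    (fun c => Metric.ball c (δ (some c))) fun c _ => Metric.ball_mem_nhds c (hδ _)
  have hfin : (insert none (some '' (t : Set ℝ)) : Set (Option ℝ)).Finite :=
    (t.finite_toSet.image _).insert _
  refine ⟨_, hfin, ?_⟩
  have hall : ∀ᶠ x in 𝓝 (0 : Fin n → ℝ), ∀ a ∈ (insert none (some '' (t : Set ℝ)) : Set (Option ℝ)),
      x ∈ polydisk fun _ : Fin n => δ a :=
    (eventually_all_finite hfin).2 fun a _ => polydisk_mem_nhds fun _ => hδ a
  filter_upwards [hall] with x hx
  have hmem : ∀ (a : Option ℝ) (l : Fin n) (s : ℝ), x ∈ polydisk (fun _ : Fin n => δ a) →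
      |s| < δ a → update x l s ∈ polydisk fun _ : Fin n => δ a := by
    intro a l s hxa hs k
    by_cases hk : k = l
    · subst hk; simpa using abs_lt.1 hs
    · simpa [update_of_ne hk] using hxa k
  by_cases hslope : |x i| ≤ (δ none)⁻¹ * |x j|
  · have hq : x j * (x i / x j) = x i := by
      by_cases hxj : x j = 0
      · have : x i = 0 := by simpa [hxj] using hslope
        simp [this]
      · field_simp
    have hqle : |x i / x j| ≤ (δ none)⁻¹ := by
      rw [abs_div]
      exact div_le_of_le_mul₀ (abs_nonneg _) (inv_nonneg.2 (hδ _).le) hslope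
    obtain ⟨c, hc, hqc⟩ := mem_iUnion₂.1 (ht (abs_le.1 hqle))
    have hcs : some c ∈ (insert none (some '' (t : Set ℝ)) : Set (Option ℝ)) :=
      Or.inr ⟨c, hc, rfl⟩
    refine mem_iUnion₂.2 ⟨some c, hcs, update x i (x i / x j - c),
      hsub _ (hmem _ _ _ (hx _ hcs) (by rwa [Metric.mem_ball, Real.dist_eq] at hqc)), ?_⟩
    simp only [ν, Option.elim, blowUpMap, update_self, update_of_ne hij.symm, update_idem]
    rw [add_sub_cancel, hq, update_eq_self]
  · push Not at hslope
    have hxi : 0 < |x i| :=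
      lt_of_le_of_lt (mul_nonneg (inv_nonneg.2 (hδ _).le) (abs_nonneg _)) hslope
    have hns : none ∈ (insert none (some '' (t : Set ℝ)) : Set (Option ℝ)) := Or.inl rfl
    refine mem_iUnion₂.2 ⟨none, hns, update x j (x j / x i), hsub _ (hmem _ _ _ (hx _ hns) ?_), ?_⟩
    · rw [abs_div, div_lt_iff₀ hxi]
      rwa [inv_mul_lt_iff₀ (hδ _)] at hslope
    · simp only [ν, Option.elim, blowUpMap, update_self, update_of_ne hij, update_idem, zero_add]
      rw [mul_div_cancel₀ _ (abs_pos.1 hxi), update_eq_self]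

theorem ramify (hH : IsLeGalRolin H) (i : Fin n) {d : ℕ} (hd : 0 < d)
    (h : ∀ ε : ℝ, ε = 1 ∨ ε = -1 → Uniformizable H fun k x => F k (ramifyMap i d ε x)) :
    Uniformizable H F := by
  have hpm : ∀ b : Bool, (bif b then (1 : ℝ) else -1) = 1 ∨ (bif b then (1 : ℝ) else -1) = -1 :=
    fun b => by cases b <;> simp
  refine of_cover (fun b : Bool => ramifyMap i d (bif b then 1 else -1))
    (fun b => ⟨fun _ => 1, fun _ => one_pos, .ramification i d hd _ (hpm b)⟩)
    (fun b => (isAlgMap_ramifyMap i hd _).tendsto hH) ?_ (fun b => h _ (hpm b))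
  intro U hU
  refine ⟨univ, finite_univ, ?_⟩
  have hd' : (d : ℝ) ≠ 0 := by exact_mod_cast hd.ne'
  let μ : (Fin n → ℝ) → (Fin n → ℝ) := fun x => update x i (|x i| ^ ((d : ℝ)⁻¹))
  have hμ : Tendsto μ (𝓝 0) (𝓝 0) := by
    have hc : Continuous μ := by
      refine continuous_id.update i (Continuous.rpow_const (by fun_prop) fun x => Or.inr ?_)
      positivity
    have h0 : μ 0 = 0 := by simp [μ, Real.zero_rpow (inv_ne_zero hd')]
    simpa [h0] using hc.tendsto 0
  filter_upwards [hμ (hU true), hμ (hU false)] with x h1 h2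
  have hroot : (|x i| ^ ((d : ℝ)⁻¹)) ^ d = |x i| := Real.rpow_inv_natCast_pow (abs_nonneg _) hd.ne'
  rcases le_total 0 (x i) with hx | hx
  · refine mem_iUnion₂.2 ⟨true, mem_univ _, μ x, h1, ?_⟩
    rw [abs_of_nonneg hx] at hroot
    simp [μ, ramifyMap, abs_of_nonneg hx, hroot]
  · refine mem_iUnion₂.2 ⟨false, mem_univ _, μ x, h2, ?_⟩
    rw [abs_of_nonpos hx] at hroot
    simp [μ, ramifyMap, abs_of_nonpos hx, hroot]

theorem eventually_sign_eq {u : (Fin n → ℝ) → ℝ} (hu : ContinuousAt u 0) (hu0 : u 0 ≠ 0) :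
    ∀ᶠ x in 𝓝 (0 : Fin n → ℝ), SignType.sign (u x) = SignType.sign (u 0) := by
  rcases lt_or_gt_of_ne hu0 with h | h
  · filter_upwards [hu.eventually (gt_mem_nhds h)] with x hx
    rw [sign_neg hx, sign_neg h]
  · filter_upwards [hu.eventually (lt_mem_nhds h)] with x hx
    rw [sign_pos hx, sign_pos h]

/-- Monomials times units have constant sign on small sub-quadrants. -/
theorem of_isMonomialUnit (hH : IsLeGalRolin H) [Finite κ]
    (hF : ∀ k, (F k =ᶠ[𝓝 0] fun _ => 0) ∨ IsMonomialUnit H (F k)) : Uniformizable H F := by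
  intro r hr
  have hsign : ∀ k, ∃ S : (Fin n → SignType) → SignType, ∀ᶠ x in 𝓝 (0 : Fin n → ℝ),
      SignType.sign (F k x) = S fun i => SignType.sign (x i) := by
    intro k
    rcases hF k with h | ⟨α, u, hu, hu0, hfu⟩
    · exact ⟨fun _ => 0, h.mono fun x hx => by simp [hx]⟩
    · refine ⟨fun σ => (∏ i, σ i ^ α i) * SignType.sign (u 0), ?_⟩
      filter_upwards [hfu, eventually_sign_eq (hu.continuousAt hH) hu0] with x h1 h2
      rw [h1, sign_mul, h2, monomial]
      congr 1
      exact (map_prod (signHom (α := ℝ)) (fun i => x i ^ α i) Finset.univ).trans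
        (Finset.prod_congr rfl fun i _ => sign_pow _ _)
  choose S hS using hsign
  obtain ⟨δ, hδ, hsub⟩ := exists_polydisk_subset
    (inter_mem (polydisk_mem_nhds hr) (eventually_all.2 hS))
  let D : SignType → Set ℝ := fun s => if s = 0 then {0} else if s = 1 then Ioo 0 δ else Ioo (-δ) 0
  have hD : ∀ s, ∀ t ∈ D s, SignType.sign t = s ∧ -δ < t ∧ t < δ := by
    intro s t ht
    rcases s with _ | _ | _
    · have ht' : t = 0 := by simpa [D] using! ht
      subst ht'
      exact ⟨sign_zero, by linarith, hδ⟩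
    · have ht' : -δ < t ∧ t < 0 := by simpa [D] using! ht
      exact ⟨sign_neg ht'.2, ht'.1, ht'.2.trans hδ⟩
    · have ht' : 0 < t ∧ t < δ := by simpa [D] using! ht
      exact ⟨sign_pos ht'.1, by linarith, ht'.2⟩
  have hQ : ∀ σ : Fin n → SignType, (Set.pi univ fun i => D (σ i)) ⊆ polydisk fun _ : Fin n => δ :=
    fun σ x hx i => (hD _ _ (hx i (mem_univ i))).2
  refine ⟨Fin n → SignType, inferInstance, fun σ => Set.pi univ fun i => D (σ i), fun _ => id,
    fun σ => ⟨⟨_, fun i => ?_, rfl⟩, r, .refl hr, fun x hx => (hsub (hQ σ hx)).1⟩, ?_, ?_⟩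
  · by_cases h0 : σ i = 0
    · left; simp [D, h0]
    · right
      refine ⟨δ, hδ, ?_⟩
      by_cases h1 : σ i = 1
      · left; simp [D, h1]
      · right; simp [D, h0, h1]
  · refine mem_of_superset (polydisk_mem_nhds (r := fun _ => δ) fun _ => hδ) fun x hx => ?_
    refine mem_iUnion.2 ⟨fun i => SignType.sign (x i), x, fun i _ => ?_, rfl⟩
    rcases lt_trichotomy (x i) 0 with h | h | h
    · simpa [D, sign_neg h] using ⟨(hx i).1, h⟩
    · simp [D, h]
    · simpa [D, sign_pos h] using ⟨h, (hx i).2⟩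
  · refine fun σ k => ⟨S k σ, fun x hx => ?_⟩
    refine ((hsub (hQ σ hx)).2 k).trans (congrArg (S k) ?_)
    exact funext fun i => (hD _ _ (hx i (mem_univ i))).1

end Uniformizable

theorem Normalizable.uniformizable (hH : IsLeGalRolin H) {n : ℕ} {f : (Fin n → ℝ) → ℝ}
    (hf : Normalizable H f) {κ : Type} [Finite κ] :
    ∀ {F : κ → (Fin n → ℝ) → ℝ}, (∀ k, GermAlg H n (F k)) →
      (∀ k, (F k =ᶠ[𝓝 0] fun _ => 0) ∨ ∃ g, GermAlg H n g ∧ (fun x => F k x * g x) =ᶠ[𝓝 0] f) →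
      Uniformizable H F := by
  have hstep : ∀ {f : (Fin n → ℝ) → ℝ} {F : κ → (Fin n → ℝ) → ℝ} {ν : (Fin n → ℝ) → (Fin n → ℝ)},
      (∀ k, (F k =ᶠ[𝓝 0] fun _ => 0) ∨ ∃ g, GermAlg H n g ∧ (fun x => F k x * g x) =ᶠ[𝓝 0] f) →
      IsAlgMap H ν → ∀ k, ((fun x => F k (ν x)) =ᶠ[𝓝 0] fun _ => 0) ∨ ∃ g, GermAlg H n g ∧
        (fun x => F k (ν x) * g x) =ᶠ[𝓝 0] fun x => f (ν x) := by
    intro f F ν hF hν k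
    rcases hF k with h | ⟨g, hg, h⟩
    · exact Or.inl (h.comp_algMap hH hν)
    · exact Or.inr ⟨_, hg.comp_map hν, h.comp_algMap hH hν⟩
  induction hf with
  | of_isMonomialUnit h =>
    intro F hA hF
    refine .of_isMonomialUnit hH fun k => (hF k).imp_right ?_
    rintro ⟨g, hg, hgf⟩
    exact .of_mul hH (hA k) hg (h.congr hgf.symm)
  | translate i h hh hi h0 _ ih =>
    intro F hA hF
    have hν := isAlgMap_translateMap i hh h0
    exact .translate hH i hh hi h0 (ih (fun k => (hA k).comp_map hν) (hstep hF hν))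
  | blowUp i j hij _ _ ih₁ ih₂ =>
    intro F hA hF
    exact .blowUp hH hij
      (fun c => ih₁ c (fun k => (hA k).comp_map (isAlgMap_blowUpMap i j c))
        (hstep hF (isAlgMap_blowUpMap i j c)))
      (ih₂ (fun k => (hA k).comp_map (isAlgMap_blowUpMap j i 0))
        (hstep hF (isAlgMap_blowUpMap j i 0)))
  | ramify i d hd _ ih =>
    intro F hA hF
    exact .ramify hH i hd fun ε hε => ih ε hε (fun k => (hA k).comp_map (isAlgMap_ramifyMap i hd ε))
      (hstep hF (isAlgMap_ramifyMap i hd ε))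

/-- Every finite family of germs of the algebra is uniformizable. -/
theorem uniformizable (hH : IsLeGalRolin H) {n : ℕ} {κ : Type} [Finite κ]
    {F : κ → (Fin n → ℝ) → ℝ} (hF : ∀ k, GermAlg H n (F k)) : Uniformizable H F := by
  classical
  cases nonempty_fintype κ
  let s : Finset κ := Finset.univ.filter fun k => ¬ F k =ᶠ[𝓝 0] fun _ => 0
  have hprod : GermAlg H n fun x => ∏ k ∈ s, F k x := GermAlg.finset_prod s fun k _ => hF k
  have hne := GermAlg.finset_prod_ne_zero hH s (f := F) (fun k _ => hF k) fun k hk => by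
    simpa [s] using hk
  refine (hprod.normalizable hH hne).uniformizable hH hF fun k => ?_
  by_cases hk : F k =ᶠ[𝓝 0] fun _ => 0
  · exact Or.inl hk
  · refine Or.inr ⟨fun x => ∏ l ∈ s.erase k, F l x, GermAlg.finset_prod _ fun l _ => hF l,
      Eventually.of_forall fun x => ?_⟩
    exact Finset.mul_prod_erase s (fun l => F l x) (by simpa [s] using hk)

/-! ### From germs to `Λ`-sets -/

theorem ElementaryFormula.continuousOn {n : ℕ} {r : Fin n → ℝ} {ν : (Fin n → ℝ) → (Fin n → ℝ)}
    (hν : ElementaryFormula H n r ν) : ContinuousOn ν (polydisk r) := by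
  cases hν with
  | blowUp i j hij c => exact Continuous.continuousOn (by fun_prop)
  | @tschirnhausen m r h hh h0 =>
    have hm : MapsTo (fun (x : Fin (m + 1) → ℝ) k => x (Fin.castSucc k)) (polydisk r)
        (polydisk fun k => r k.castSucc) := fun x hx k => hx _
    have hc := hh.1.comp (Continuous.continuousOn (by fun_prop)) hm
    refine continuousOn_pi.2 fun k => ?_
    by_cases hk : k = Fin.last m
    · subst hk
      simp only [update_self]
      exact (Continuous.continuousOn (by fun_prop)).add hc
    · simp only [update_of_ne hk]
      exact Continuous.continuousOn (by fun_prop)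
  | shear i c =>
    refine Continuous.continuousOn (continuous_pi fun k => ?_)
    split_ifs <;> fun_prop
  | ramification i d hd ε hε => exact Continuous.continuousOn (by fun_prop)

theorem IsAdmissible.mapsTo_continuousOn {n : ℕ} {r' r : Fin n → ℝ}
    {ρ : (Fin n → ℝ) → (Fin n → ℝ)} (hρ : IsAdmissible H r' r ρ) :
    MapsTo ρ (polydisk r') (polydisk r) ∧ ContinuousOn ρ (polydisk r') := by
  induction hρ with
  | refl _ => exact ⟨mapsTo_id _, continuousOn_id⟩
  | comp hν _ ih => exact ⟨hν.2.2.1.comp ih.1, hν.2.2.2.continuousOn.comp ih.2 ih.1⟩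

theorem IsAdmissibleOn.continuousOn {n : ℕ} {Q : Set (Fin n → ℝ)}
    {ρ : (Fin n → ℝ) → (Fin n → ℝ)} (hρ : IsAdmissibleOn H Q ρ) : ContinuousOn ρ Q := by
  obtain ⟨r', r, h, hQ⟩ := hρ
  exact h.mapsTo_continuousOn.2.mono hQ

theorem IsSubQuadrant.isConnected {n : ℕ} {Q : Set (Fin n → ℝ)} (hQ : IsSubQuadrant Q) :
    IsConnected Q := by
  obtain ⟨D, hD, rfl⟩ := hQ
  refine isConnected_univ_pi.2 fun i => ?_
  rcases hD i with h | ⟨s, hs, h | h⟩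
  · rw [h]; exact isConnected_singleton
  · rw [h]; exact isConnected_Ioo hs
  · rw [h]; exact isConnected_Ioo (by linarith)

/-- Near each point, the set is a finite union of images of sub-quadrants. -/
theorem IsHSemianalytic.exists_local_cover (hH : IsLeGalRolin H) {n : ℕ} {A : Set (Fin n → ℝ)}
    (hA : IsHSemianalytic H A) (a : Fin n → ℝ) :
    ∃ W ∈ 𝓝 a, ∃ (ι : Type) (_ : Finite ι) (Q : ι → Set (Fin n → ℝ))
      (ρ : ι → (Fin n → ℝ) → (Fin n → ℝ)),
      (∀ i, IsSubQuadrant (Q i) ∧ IsAdmissibleOn H (Q i) (ρ i)) ∧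
      A ∩ W = ⋃ i, (fun x => a + ρ i x) '' Q i := by
  obtain ⟨r, hr, k, B, hB, hAB⟩ := hA a
  choose rb q g₀ g hrb hg₀ hg hBeq using hB
  let F : (Σ j : Fin k, Option (Fin (q j))) → (Fin n → ℝ) → ℝ := fun p =>
    p.2.elim (g₀ p.1) (g p.1)
  have hF : ∀ p, GermAlg H n (F p) := by
    rintro ⟨j, l⟩
    cases l with
    | none => exact (hg₀ j).2
    | some l => exact (hg j l).2
  obtain ⟨δ, hδ, hsub⟩ := exists_polydisk_subset (inter_mem (polydisk_mem_nhds hr)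
    (eventually_all.2 fun j => polydisk_mem_nhds (hrb j)))
  obtain ⟨ι, hι, Q, ρ, hQ, hcov, hsign⟩ := uniformizable hH hF (fun _ => δ) fun _ => hδ
  have hmaps : ∀ i, ∀ x ∈ Q i, ρ i x ∈ polydisk fun _ : Fin n => δ := by
    intro i x hx
    obtain ⟨r', h, hQr⟩ := (hQ i).2
    exact h.mapsTo_continuousOn.1 (hQr hx)
  have hconst : ∀ i, ∀ x ∈ Q i, ∀ y ∈ Q i, a + ρ i x ∈ A → a + ρ i y ∈ A := by
    intro i x hx y hy hxA
    have h1 : ρ i x ∈ {x | a + x ∈ A} ∩ polydisk r := ⟨hxA, (hsub (hmaps i x hx)).1⟩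
    rw [hAB] at h1
    obtain ⟨j, hj⟩ := mem_iUnion.1 h1
    have hsg : ∀ p, SignType.sign (F p (ρ i y)) = SignType.sign (F p (ρ i x)) := fun p => by
      obtain ⟨s, hs⟩ := hsign i p
      rw [hs x hx, hs y hy]
    have h2 : ρ i y ∈ ⋃ j, B j := by
      refine mem_iUnion.2 ⟨j, ?_⟩
      rw [hBeq j] at hj ⊢
      refine ⟨(hsub (hmaps i y hy)).2 j, ?_, fun l => ?_⟩
      · have := hsg ⟨j, none⟩
        simp only [F, Option.elim, hj.2.1, sign_zero] at this
        exact sign_eq_zero_iff.1 this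
      · have := hsg ⟨j, some l⟩
        simp only [F, Option.elim, sign_pos (hj.2.2 l)] at this
        exact sign_eq_one_iff.1 this
    rw [← hAB] at h2
    exact h2.1
  have hW : {y | y - a ∈ ⋃ i, ρ i '' Q i} ∈ 𝓝 a := by
    have : Tendsto (fun y : Fin n → ℝ => y - a) (𝓝 a) (𝓝 0) := by
      simpa using (continuous_id.sub continuous_const).tendsto (f := fun y : Fin n → ℝ => y - a) a
    exact this hcov
  refine ⟨_, hW, {i // ∃ x ∈ Q i, a + ρ i x ∈ A}, inferInstance, fun i => Q i, fun i => ρ i,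
    fun i => ⟨(hQ i).1, ?_⟩, ?_⟩
  · obtain ⟨r', h, hQr⟩ := (hQ i).2
    exact ⟨r', _, h, hQr⟩
  · ext y
    simp only [mem_inter_iff, mem_iUnion, mem_image, mem_ofPred_eq]
    constructor
    · rintro ⟨hyA, i, x, hx, hxy⟩
      have hy : a + ρ i x = y := by rw [hxy]; abel
      exact ⟨⟨i, x, hx, hy ▸ hyA⟩, x, hx, hy⟩
    · rintro ⟨⟨i, x', hx', hA'⟩, x, hx, rfl⟩
      exact ⟨hconst i x' hx' x hx hA', i, x, hx, by simp⟩

/-- A set covered by finitely many continuous images of connected sets that it contains has finitely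
many connected components. -/
theorem finite_connectedComponents_of_iUnion_image {X Y ι : Type*} [TopologicalSpace X]
    [TopologicalSpace Y] [Finite ι] {A : Set Y} {Q : ι → Set X} {f : ι → X → Y}
    (hQ : ∀ i, IsConnected (Q i)) (hf : ∀ i, ContinuousOn (f i) (Q i))
    (hA : A = ⋃ i, f i '' Q i) : Finite (ConnectedComponents A) := by
  have hmem : ∀ i, ∀ x ∈ Q i, f i x ∈ A := fun i x hx => by
    rw [hA]; exact mem_iUnion.2 ⟨i, x, hx, rfl⟩
  choose q hq using fun i => (hQ i).nonempty
  refine Finite.of_surjective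
    (fun i => (ConnectedComponents.mk (⟨f i (q i), hmem i _ (hq i)⟩ : A))) ?_
  intro c
  obtain ⟨⟨y, hy⟩, rfl⟩ := ConnectedComponents.surjective_coe c
  have hy' := hy
  rw [hA] at hy'
  obtain ⟨i, x, hx, rfl⟩ := mem_iUnion.1 hy'
  refine ⟨i, ?_⟩
  have : PreconnectedSpace (Q i) := isPreconnected_iff_preconnectedSpace.1 (hQ i).isPreconnected
  let F : Q i → A := fun z => ⟨f i z, hmem i z z.2⟩
  have hF : Continuous F := (continuousOn_iff_continuous_domRestrict.1 (hf i)).subtype_mk _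
  exact ConnectedComponents.coe_eq_coe'.2 ((isPreconnected_range hF).subset_connectedComponent
    (mem_range_self (⟨x, hx⟩ : Q i)) (mem_range_self (⟨q i, hq i⟩ : Q i)))

end HSets

theorem mainTheorem7 (H : ℝ → ℝ) (hH : HSets.IsLeGalRolin H)
    (n : ℕ) (A : Set (Fin n → ℝ)) (hA : HSets.IsLambdaSet H A) :
    (∃ (p : ℕ) (a : Fin p → (Fin n → ℝ)) (Q : Fin p → Set (Fin n → ℝ))
        (ρ : Fin p → (Fin n → ℝ) → (Fin n → ℝ)),
      (∀ i, HSets.IsSubQuadrant (Q i) ∧ HSets.IsAdmissibleOn H (Q i) (ρ i)) ∧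
      A = ⋃ i, (fun x => a i + ρ i x) '' Q i) ∧
    Finite (ConnectedComponents A) := by
  have hcover : ∃ (p : ℕ) (a : Fin p → (Fin n → ℝ)) (Q : Fin p → Set (Fin n → ℝ))
        (ρ : Fin p → (Fin n → ℝ) → (Fin n → ℝ)),
      (∀ i, HSets.IsSubQuadrant (Q i) ∧ HSets.IsAdmissibleOn H (Q i) (ρ i)) ∧
      A = ⋃ i, (fun x => a i + ρ i x) '' Q i := by
    choose W hW ι hι Q ρ hQ hAW using hA.1.exists_local_cover hH
    obtain ⟨t, -, ht⟩ := hA.2.isCompact_closure.elim_nhds_subcover W fun a _ => hW a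
    obtain ⟨p, ⟨e⟩⟩ := Finite.exists_equiv_fin (Σ a : t, ι a)
    refine ⟨p, fun i => (e.symm i).1, fun i => Q _ (e.symm i).2, fun i => ρ _ (e.symm i).2,
      fun i => hQ _ _, ?_⟩
    rw [e.symm.surjective.iUnion_comp
      (fun q : Σ a : t, ι a => (fun x => (q.1 : Fin n → ℝ) + ρ _ q.2 x) '' Q _ q.2),
      iUnion_sigma]
    simp only [← hAW]
    rw [← inter_iUnion]
    refine (inter_eq_left.2 fun x hx => ?_).symm
    obtain ⟨a, ha, hxa⟩ := mem_iUnion₂.1 (ht (subset_closure hx))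
    exact mem_iUnion.2 ⟨⟨a, ha⟩, hxa⟩
  refine ⟨hcover, ?_⟩
  obtain ⟨p, a, Q, ρ, hQ, hAQ⟩ := hcover
  exact HSets.finite_connectedComponents_of_iUnion_image (fun i => (hQ i).1.isConnected)
    (fun i => continuousOn_const.add (hQ i).2.continuousOn) hAQ
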